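/- Let $T>0$, write $\pi_t(k)=e^{-t}t^k/k!$ ($k\in\mathbb N=\{0,1,\dots\}$) for the Poisson measure with intensity $t\ge 0$, and let $P_tf(k)=\sum_{n\ge0}f(k+n)\pi_t(n)$, so that $P_0f=f$. Let $f:\mathbb N\to(0,\infty)$ satisfy $\sum_k f(k)\pi_T(k)=1$ and $\sum_k f(k)|\log f(k)|\,\pi_T(k)<\infty$ (the latter is automatic if $f$ is bounded), and let $\mu=f\pi_T$. Put $$\delta(f)=T\sum_{k\ge0}f(k+1)\Big\{\log\frac{f(k+1)}{f(k)}-1+\frac{f(k)}{f(k+1)}\Big\}\pi_T(k)-\operatorname{Ent}_{\pi_T}[f]\in(-\infty,\infty],$$ where $$\operatorname{Ent}_{\pi_T}[f]=\sum_k f(k)\log f(k)\,\pi_T(k)-\Big(\sum_k f(k)\pi_T(k)\Big)\log\Big(\sum_k f(k)\pi_T(k)\Big).$$ Let $N$ be a Poisson point process on $[0,T]\times[0,\infty)$ with Lebesgue intensity, and let $\mathcal F_t$ be the $\sigma$-algebra generated by the variables $N(B)$ with $B\subset[0,t]\times[0,\infty)$ Borel. Let $(X_t,\lambda_t)_{t\in[0,T]}$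 be the Poisson–Föllmer process associated with $\mu$: $X_t$ takes values in $\mathbb N$, $\lambda$ is predictable (measurable for the $\sigma$-algebra on $[0,T]\times\Omega$ generated by the sets $(s,t]\times A$ with $0\le s\le t\le T$, $A\in\mathcal F_s$) and, almost surely, for all $t\in[0,T]$, $$X_t=N\big(\{(s,x)\in[0,T]\times[0,\infty):s<t,\ x\le\lambda_s\}\big),\qquad \lambda_t=\frac{P_{T-t}f(X_t+1)}{P_{T-t}f(X_t)}.$$ Write $F(t,k)=\log P_{T-t}f(k)$, $Dg(k)=g(k+1)-g(k)$, $D^2=D\circ D$ (acting in the variable $k$), and let $H(\cdot|\cdot)$ be the relative entropy. Then $$\delta(f)=\int_0^T\int_t^T\mathbb E\Big[\lambda_s^2\,H\big(\pi_{e^{D^2F(s,X_s)}}\,\big|\,\pi_1\big)\Big]\,ds\,dt ,$$ as an identity in $[0,\infty]$ (in particular, one side is infinite if and only if the other is). -/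

import Mathlib

open MeasureTheory ProbabilityTheory Set
open scoped ENNReal NNReal

namespace PoissonFollmer

noncomputable section

/-! ### Poisson weights, Poisson semigroup, Wu's deficit -/

/-- The weight `π_t(k) = e^{-t} t^k / k!` of the Poisson measure with intensity `t`
(the weights of `poissonMeasure` when `0 ≤ t`; `π_0` is the unit mass at `0`). -/
def poissonWeight (t : ℝ) (k : ℕ) : ℝ :=
  Real.exp (-t) * t ^ k / (Nat.factorial k : ℝ)

/-- The Poisson semigroup `P_t f(k) = ∑ₙ f(k+n) π_t(n)` (so `P_0 f = f`). -/
def poissonSemigroup (t : ℝ) (f : ℕ → ℝ) (k : ℕ) : ℝ :=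
  ∑' n : ℕ, f (k + n) * poissonWeight t n

/-- `F(t,k) = log P_{T-t} f(k)`. -/
def logSemigroup (T : ℝ) (f : ℕ → ℝ) (t : ℝ) (k : ℕ) : ℝ :=
  Real.log (poissonSemigroup (T - t) f k)

/-- The discrete derivative `D g(k) = g(k+1) - g(k)`. -/
def discreteDeriv (g : ℕ → ℝ) (k : ℕ) : ℝ := g (k + 1) - g k

/-- `Ent_{π_T}[f] = ∑ f log f π_T - (∑ f π_T) log (∑ f π_T)`, meaningful when
both `f` and `f log f` are `π_T`-summable. -/
def entropy (T : ℝ) (f : ℕ → ℝ) : ℝ :=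
  (∑' k : ℕ, f k * Real.log (f k) * poissonWeight T k)
    - (∑' k : ℕ, f k * poissonWeight T k) * Real.log (∑' k : ℕ, f k * poissonWeight T k)

/-- The right-hand side of Wu's inequality,
`T ∑ₖ f(k+1) {log (f(k+1)/f(k)) - 1 + f(k)/f(k+1)} π_T(k) ∈ [0, ∞]`.
For positive `f` every term is nonnegative, because `log r - 1 + 1/r ≥ 0` for `r > 0`, so
`ENNReal.ofReal` truncates nothing. -/
def wuFunctional (T : ℝ) (f : ℕ → ℝ) : ℝ≥0∞ :=
  ENNReal.ofReal T * ∑' k : ℕ, ENNReal.ofReal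
    (f (k + 1) * (Real.log (f (k + 1) / f k) - 1 + f k / f (k + 1)) * poissonWeight T k)

/-- The deficit `δ(f)` in Wu's inequality. It is `+∞` when the right-hand side of Wu's inequality
is `+∞`. -/
def deficit (T : ℝ) (f : ℕ → ℝ) : EReal :=
  ((wuFunctional T f : ℝ≥0∞) : EReal) - ((entropy T f : ℝ) : EReal)

/-! ### Poisson point processes and their predictable processes -/

/-- `N` is a Poisson point process on the plane with intensity measure `ν`: a random integer-valued
locally finite measure whose counts of measurable sets of finite intensity are Poisson, and whose
counts of disjoint sets are independent. -/
structure IsPoissonPointProcess {Ω : Type*} [MeasurableSpace Ω]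
    (N : Ω → Measure (ℝ × ℝ)) (ν : Measure (ℝ × ℝ)) (P : Measure Ω) : Prop where
  measurable_count : ∀ B : Set (ℝ × ℝ), MeasurableSet B → Measurable (fun ω => N ω B)
  count_nat : ∀ (ω : Ω) (B : Set (ℝ × ℝ)), MeasurableSet B → Bornology.IsBounded B →
    ∃ n : ℕ, N ω B = (n : ℝ≥0∞)
  law_count : ∀ B : Set (ℝ × ℝ), MeasurableSet B → ν B ≠ ∞ →
    P.map (fun ω => N ω B) =
      (poissonMeasure (ν B).toNNReal).map (fun n : ℕ => (n : ℝ≥0∞))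
  indep_count : ∀ (n : ℕ) (B : Fin n → Set (ℝ × ℝ)), (∀ i, MeasurableSet (B i)) →
    Pairwise (fun i j => Disjoint (B i) (B j)) → iIndepFun (fun i ω => N ω (B i)) P

/-- The σ-algebra `𝓕_t = σ(N(B) : B ⊆ [0,t] × [0,∞) Borel)`. -/
def pointSigma {Ω : Type*} (N : Ω → Measure (ℝ × ℝ)) (t : ℝ) : MeasurableSpace Ω :=
  ⨆ B : {B : Set (ℝ × ℝ) // MeasurableSet B ∧ B ⊆ Icc 0 t ×ˢ Ici 0},
    MeasurableSpace.comap (fun ω => N ω B.1) inferInstance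

/-- The predictable σ-algebra on `[0,T] × Ω`, generated by the sets `(s,t] × A` with
`0 ≤ s ≤ t ≤ T` and `A ∈ 𝓕_s`. -/
def predictableSigma {Ω : Type*} (N : Ω → Measure (ℝ × ℝ)) (T : ℝ) :
    MeasurableSpace (Icc (0 : ℝ) T × Ω) :=
  MeasurableSpace.generateFrom
    {S | ∃ (s t : ℝ) (A : Set Ω), 0 ≤ s ∧ s ≤ t ∧ t ≤ T ∧ MeasurableSet[pointSigma N s] A ∧
      S = {p : Icc (0 : ℝ) T × Ω | s < (p.1 : ℝ) ∧ (p.1 : ℝ) ≤ t ∧ p.2 ∈ A}}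

/-- The number of points under the curve `l` before time `t`,
`X_t^l(ω) = N({(s,x) ∈ [0,T] × [0,∞) : s < t, x ≤ l_s(ω)})`. -/
def thinnedCount {Ω : Type*} (N : Ω → Measure (ℝ × ℝ)) (T : ℝ) (l : ℝ → Ω → ℝ)
    (t : ℝ) (ω : Ω) : ℝ≥0∞ :=
  N ω {p : ℝ × ℝ | p ∈ Icc 0 T ×ˢ Ici 0 ∧ p.1 < t ∧ p.2 ≤ l p.1 ω}

/-- `(X, l)` is the Poisson–Föllmer process of `μ = f π_T` with its intensity, driven by the Poisson
point process `N` on `[0,T] × [0,∞)` with Lebesgue intensity: `l` is predictable, `X = X^l`,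
and `l_t = P_{T-t} f(X_t + 1) / P_{T-t} f(X_t)`. -/
structure IsPoissonFollmer {Ω : Type*} [MeasurableSpace Ω] (P : Measure Ω)
    (N : Ω → Measure (ℝ × ℝ)) (T : ℝ) (f : ℕ → ℝ) (X : ℝ → Ω → ℕ) (l : ℝ → Ω → ℝ) : Prop where
  poisson : IsPoissonPointProcess N (volume.restrict (Icc 0 T ×ˢ Ici 0)) P
  predictable : Measurable[predictableSigma N T]
    (fun p : Icc (0 : ℝ) T × Ω => l (p.1 : ℝ) p.2)
  count : ∀ᵐ ω ∂P, ∀ t ∈ Icc (0 : ℝ) T, thinnedCount N T l t ω = (X t ω : ℝ≥0∞)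
  intensity : ∀ᵐ ω ∂P, ∀ t ∈ Icc (0 : ℝ) T,
    l t ω = poissonSemigroup (T - t) f (X t ω + 1) / poissonSemigroup (T - t) f (X t ω)

end

end PoissonFollmer

/-!
Put `u(s, k) = P_{T-s} f(k)` and `F = log u`. Two facts prove the identity.

*The law of the process.* `X_s` has law `u(s, ·) π_s` for `0 < s ≤ T`. Hence the expectation on the
right-hand side is the sum over `k`, with weights `π_s(k)`, of `(b²/a) (α log α - α + 1)`, where
`a, b, c` are the values of `u(s, ·)` at `k, k + 1, k + 2` and `α = ca/b²`; here the relative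
entropy of `π_α` with respect to `π_1` is `α log α - α + 1`, the function `klFun` of Mathlib
(`klDiv_poissonMeasure_one`).

*Two derivatives of the entropy.* The Poisson measures satisfy
`d/ds ∫ g_s dπ_s = ∫ (∂_s g + Dg) dπ_s`, and `∂_s u = -Du`. For `g = klFun u` the integrand on the
right is `entropyRate (u(k)) (u(k+1))`, and for `g = entropyRate` it is the expression above, called
`entropyRateDeriv`. The entropy at time `s` is the integral of `klFun u`: it increases from `0` at
`s = 0` to `Ent f` at `s = T`. Let `φ(s)` be the mean of `entropyRate` at time `s`, so that `T φ(T)`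
is Wu's functional. Then `Ent f = ∫₀ᵀ φ` and `φ(T) - φ(t) = ∫ₜᵀ φ'`, whence
`T φ(T) - Ent f = ∫₀ᵀ ∫ₜᵀ φ'` (`deficit_eq_lintegral`).

Second moments need not exist, so that the differentiation under the sum is carried out with values
in `[0, ∞]` (`poissonMean_eq_add_lintegral`): the sums over `k < M` leave a flux through `M` which,
by integrability in time of `∫ g_s dπ_s`, is small for infinitely many `M`. For `klFun u` this
integrability is Jensen's inequality (`entropyAt_le`); for `entropyRate` it is the first of the two
identities.

The law is found from the forward equation. While the process is in the state `k`, it leaves it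
exactly when a point appears under the graph of the rate `u(s, k+1) / u(s, k)` of this state
(`count_eq_iff`), a region whose points are independent of the past
(`IsPoissonPointProcess.indep_pointSigma`), and two jumps in a time `h` have probability `O(h²)`.
This gives the right derivatives of `P(X_t < k)`. The rate is the derivative of
`V = s - log u(s, k)`, so that by induction on `k` the difference between the true and the expected distribution function,
multiplied by `exp V`, is constant on `(0, T]` (`abs_sub_lowerMass_le`); as `V` increases and both
distributions are concentrated at `0` as `t → 0`, the difference vanishes.
-/

namespace PoissonFollmer

open Filter Topology InformationTheory

noncomputable section

/-! ### The Poisson semigroup applied to a density -/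

lemma poissonWeight_nonneg {t : ℝ} (ht : 0 ≤ t) (k : ℕ) : 0 ≤ poissonWeight t k := by
  unfold poissonWeight; positivity

lemma poissonWeight_zero (t : ℝ) : poissonWeight t 0 = Real.exp (-t) := by
  simp [poissonWeight]

lemma hasSum_poissonWeight (t : ℝ) : HasSum (poissonWeight t) 1 := by
  have h := (NormedSpace.expSeries_div_hasSum_exp t).mul_left (Real.exp (-t))
  rw [← Real.exp_eq_exp_ℝ, ← Real.exp_add, neg_add_cancel, Real.exp_zero] at h
  convert! h using 2
  simp [poissonWeight, mul_div_assoc]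

/-- Shifting the index of the Poisson weights trades a factor `k + 1` for a factor `t`. -/
lemma succ_mul_poissonWeight_succ (t : ℝ) (k : ℕ) :
    (k + 1 : ℝ) * poissonWeight t (k + 1) = t * poissonWeight t k := by
  unfold poissonWeight
  rw [Nat.factorial_succ]
  have : (k.factorial : ℝ) ≠ 0 := by positivity
  push_cast
  field_simp
  ring

/-- The shifted Poisson weight `π_t(k-1)`, with value `0` at `k = 0`. -/
def poissonWeightPred (t : ℝ) : ℕ → ℝ
  | 0 => 0
  | k + 1 => poissonWeight t k

lemma poissonWeightPred_nonneg {t : ℝ} (ht : 0 ≤ t) (k : ℕ) : 0 ≤ poissonWeightPred t k := by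
  cases k with
  | zero => exact le_rfl
  | succ k => exact poissonWeight_nonneg ht k

lemma mul_poissonWeightPred (t : ℝ) (k : ℕ) :
    t * poissonWeightPred t k = k * poissonWeight t k := by
  cases k with
  | zero => simp [poissonWeightPred]
  | succ k => simpa [poissonWeightPred] using (succ_mul_poissonWeight_succ t k).symm

lemma hasDerivAt_poissonWeight (t : ℝ) (k : ℕ) :
    HasDerivAt (fun s => poissonWeight s k) (poissonWeightPred t k - poissonWeight t k) t := by
  unfold poissonWeight
  have h1 : HasDerivAt (fun s : ℝ => Real.exp (-s)) (-Real.exp (-t)) t := by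
    simpa using (hasDerivAt_neg t).exp
  have h2 := (h1.mul (hasDerivAt_pow k t)).div_const (k.factorial : ℝ)
  convert! h2 using 1
  cases k with
  | zero => simp [poissonWeightPred]
  | succ k =>
    have : (k.factorial : ℝ) ≠ 0 := by positivity
    simp only [poissonWeightPred, poissonWeight, Nat.factorial_succ]
    push_cast
    field_simp
    ring

lemma continuous_poissonWeight (k : ℕ) : Continuous fun s => poissonWeight s k :=
  continuous_iff_continuousAt.2 fun t => (hasDerivAt_poissonWeight t k).continuousAt

lemma continuous_poissonWeightPred (k : ℕ) : Continuous fun s => poissonWeightPred s k := by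
  cases k with
  | zero => exact continuous_const
  | succ k => exact continuous_poissonWeight k

/-- The binomial theorem: `π_a * π_b = π_{a+b}`. -/
lemma sum_antidiagonal_poissonWeight (a b : ℝ) (m : ℕ) :
    ∑ p ∈ Finset.HasAntidiagonal.antidiagonal m, poissonWeight a p.1 * poissonWeight b p.2
      = poissonWeight (a + b) m := by
  unfold poissonWeight
  rw [(Commute.all a b).add_pow', Finset.mul_sum, Finset.sum_div]
  refine Finset.sum_congr rfl fun p hp => ?_
  have hp' := Finset.HasAntidiagonal.mem_antidiagonal.1 hp
  subst hp'
  have h := Nat.add_choose_mul_factorial_mul_factorial p.1 p.2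
  have h' : ((p.1 + p.2).choose p.1 : ℝ) * p.1.factorial * p.2.factorial
      = (p.1 + p.2).factorial := by
    rw [Nat.choose_symm_add]
    exact_mod_cast h
  have h1 : (p.1.factorial : ℝ) ≠ 0 := by positivity
  have h2 : (p.2.factorial : ℝ) ≠ 0 := by positivity
  rw [neg_add, Real.exp_add, ← h', nsmul_eq_mul]
  have h3 : ((p.1 + p.2).choose p.1 : ℝ) ≠ 0 := by
    exact_mod_cast (Nat.choose_pos (Nat.le_add_right _ _)).ne'
  field_simp

/-- The semigroup identity `∫ P_b g dπ_a = ∫ g dπ_{a+b}`, for `[0, ∞]`-valued `g`. -/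
lemma tsum_tsum_poissonWeight {a b : ℝ} (ha : 0 ≤ a) (hb : 0 ≤ b) (g : ℕ → ℝ≥0∞) :
    ∑' k, (∑' n, g (k + n) * ENNReal.ofReal (poissonWeight b n)) *
        ENNReal.ofReal (poissonWeight a k)
      = ∑' m, g m * ENNReal.ofReal (poissonWeight (a + b) m) := by
  simp_rw [← ENNReal.tsum_mul_right]
  rw [← ENNReal.tsum_prod (f := fun k n => g (k + n) * ENNReal.ofReal (poissonWeight b n) *
    ENNReal.ofReal (poissonWeight a k)), ← Finset.HasAntidiagonal.sigmaAntidiagonalEquivProd.tsum_eq,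
    ENNReal.tsum_sigma']
  refine tsum_congr fun m => ?_
  rw [← sum_antidiagonal_poissonWeight, ENNReal.ofReal_sum_of_nonneg fun p _ =>
    mul_nonneg (poissonWeight_nonneg ha _) (poissonWeight_nonneg hb _), Finset.mul_sum,
    ← Finset.tsum_subtype]
  refine tsum_congr fun p => ?_
  have hp := Finset.HasAntidiagonal.mem_antidiagonal.1 p.2
  simp only [Finset.HasAntidiagonal.sigmaAntidiagonalEquivProd_apply, hp]
  rw [ENNReal.ofReal_mul (poissonWeight_nonneg ha _)]
  ring

/-- The evolved density `P_{T-s} f`, as a function of the time `s` and the state. -/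
def evolved (T : ℝ) (f : ℕ → ℝ) (s : ℝ) (k : ℕ) : ℝ := poissonSemigroup (T - s) f k

section Semigroup

variable {T : ℝ} {f : ℕ → ℝ}

/-- Inside the disc of radius `T` the exponential generating series of every shift of `f`
converges, although at the radius `T` itself only the unshifted one need do so. -/
lemma summable_shift (hT : 0 < T) (hf : ∀ k, 0 < f k)
    (hs : Summable fun k => f k * poissonWeight T k) (k : ℕ) {x : ℝ} (hx : |x| < T) :
    Summable fun n : ℕ => f (k + n) * (x ^ n / n.factorial) := by
  obtain ⟨B, hB⟩ : ∃ B, ∀ m, f m * poissonWeight T m ≤ B :=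
    ⟨_, fun m => hs.le_tsum m fun j _ => mul_nonneg (hf j).le (poissonWeight_nonneg hT.le j)⟩
  have hρ : ‖|x| / T‖ < 1 := by
    rw [Real.norm_eq_abs, abs_of_nonneg (by positivity), div_lt_one hT]; exact hx
  have hsum := (summable_choose_mul_geometric_of_norm_lt_one k hρ).mul_left
    (B * Real.exp T * k.factorial / T ^ k)
  refine Summable.of_norm_bounded hsum fun n => ?_
  have hm : f (k + n) ≤ B * Real.exp T * (k + n).factorial / T ^ (k + n) := by
    have h := hB (k + n)
    unfold poissonWeight at h
    rw [le_div_iff₀ (by positivity)]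
    rw [mul_div_assoc', div_le_iff₀ (by positivity), Real.exp_neg] at h
    have h' := mul_le_mul_of_nonneg_left h (Real.exp_pos T).le
    calc f (k + n) * T ^ (k + n)
        = Real.exp T * (f (k + n) * ((Real.exp T)⁻¹ * T ^ (k + n))) := by
          field_simp
      _ ≤ _ := h'
      _ = _ := by ring
  have hc : ((k + n).factorial : ℝ) = (n + k).choose k * k.factorial * n.factorial := by
    have h := Nat.add_choose_mul_factorial_mul_factorial k n
    rw [add_comm n k, Nat.choose_symm_add]
    exact_mod_cast h.symm
  rw [norm_mul, Real.norm_of_nonneg (hf _).le, Real.norm_eq_abs, abs_div, abs_pow, Nat.abs_cast]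
  calc f (k + n) * (|x| ^ n / n.factorial)
      ≤ (B * Real.exp T * (k + n).factorial / T ^ (k + n)) * (|x| ^ n / n.factorial) := by
        gcongr
    _ = B * Real.exp T * k.factorial / T ^ k * ((n + k).choose k * (|x| / T) ^ n) := by
        rw [hc, pow_add, div_pow]
        have : (n.factorial : ℝ) ≠ 0 := by positivity
        field_simp

lemma summable_evolved (hT : 0 < T) (hf : ∀ k, 0 < f k)
    (hs : Summable fun k => f k * poissonWeight T k) (k : ℕ) {s : ℝ} (hs0 : |T - s| < T) :
    Summable fun n : ℕ => f (k + n) * poissonWeight (T - s) n := by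
  refine ((summable_shift hT hf hs k hs0).mul_left (Real.exp (-(T - s)))).congr fun n => ?_
  unfold poissonWeight; ring

lemma abs_sub_lt_of_mem_Ioc {s : ℝ} (h : s ∈ Ioc 0 T) : |T - s| < T := by
  rw [abs_of_nonneg (by linarith [h.2])]; linarith [h.1]

lemma evolved_pos (hT : 0 < T) (hf : ∀ k, 0 < f k)
    (hs : Summable fun k => f k * poissonWeight T k) (k : ℕ) {s : ℝ} (hs0 : s ∈ Ioc 0 T) :
    0 < evolved T f s k := by
  have h := summable_evolved hT hf hs k (abs_sub_lt_of_mem_Ioc hs0)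
  refine h.tsum_pos (fun n => mul_nonneg (hf _).le (poissonWeight_nonneg (by linarith [hs0.2]) _))
    0 ?_
  rw [poissonWeight_zero]
  exact mul_pos (hf _) (Real.exp_pos _)

lemma hasDerivAt_shift_tsum (hT : 0 < T) (hf : ∀ k, 0 < f k)
    (hs : Summable fun k => f k * poissonWeight T k) (k : ℕ) {x : ℝ} (hx : |x| < T) :
    HasDerivAt (fun y : ℝ => ∑' n : ℕ, f (k + n) * (y ^ n / n.factorial))
      (∑' n : ℕ, f (k + 1 + n) * (x ^ n / n.factorial)) x := by
  obtain ⟨ρ, hxρ, hρT⟩ := exists_between hx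
  have hρ0 : 0 ≤ ρ := (abs_nonneg x).trans hxρ.le
  -- The derivative of the `n`-th term is the `(n-1)`-st term of the next shift.
  let u : ℕ → ℝ := fun n => f (k + n) * (n * ρ ^ (n - 1) / n.factorial)
  have hshift : ∀ (y : ℝ) (n : ℕ), f (k + (n + 1)) * (((n + 1 : ℕ) : ℝ) * y ^ (n + 1 - 1) /
      (n + 1).factorial) = f (k + 1 + n) * (y ^ n / n.factorial) := by
    intro y n
    have : (n.factorial : ℝ) ≠ 0 := by positivity
    rw [Nat.factorial_succ, show k + (n + 1) = k + 1 + n by ring]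
    push_cast
    field_simp
  have hu : Summable u := by
    rw [← summable_nat_add_iff 1]
    refine (summable_shift hT hf hs (k + 1) (x := ρ) (by rwa [abs_of_nonneg hρ0])).congr
      fun n => ?_
    exact (hshift ρ n).symm
  have key := hasDerivAt_tsum_of_isPreconnected (𝕜 := ℝ) (u := u)
    (g := fun n y => f (k + n) * (y ^ n / n.factorial))
    (g' := fun n y => f (k + n) * (n * y ^ (n - 1) / n.factorial))
    (t := Ioo (-ρ) ρ) (y₀ := x) (y := x) hu isOpen_Ioo isPreconnected_Ioo
    (fun n y _ => ((hasDerivAt_pow n y).div_const _).const_mul _) (fun n y hy => ?_)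
    (abs_lt.1 hxρ) (summable_shift hT hf hs k hx) (abs_lt.1 hxρ)
  · convert! key using 1
    have hsum : Summable fun n : ℕ => f (k + n) * (n * x ^ (n - 1) / n.factorial) := by
      rw [← summable_nat_add_iff 1]
      exact (summable_shift hT hf hs (k + 1) hx).congr fun n => (hshift x n).symm
    rw [hsum.tsum_eq_zero_add]
    simp only [Nat.cast_zero, zero_mul, zero_div, mul_zero, zero_add]
    exact tsum_congr fun n => (hshift x n).symm
  · rw [norm_mul, Real.norm_of_nonneg (hf _).le, norm_div, norm_mul, norm_pow,
      Real.norm_natCast, Real.norm_natCast]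
    have : ‖y‖ ≤ ρ := (abs_lt.2 hy).le
    have := (hf (k + n)).le
    simp only [u]
    gcongr

/-- The backward equation `∂_s P_{T-s} f = -D P_{T-s} f`. -/
lemma hasDerivAt_evolved (hT : 0 < T) (hf : ∀ k, 0 < f k)
    (hs : Summable fun k => f k * poissonWeight T k) (k : ℕ) {s : ℝ} (hs0 : |T - s| < T) :
    HasDerivAt (fun s => evolved T f s k) (evolved T f s k - evolved T f s (k + 1)) s := by
  have heq : ∀ (s : ℝ) (k : ℕ), evolved T f s k
      = Real.exp (-(T - s)) * ∑' n : ℕ, f (k + n) * ((T - s) ^ n / n.factorial) := by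
    intro s k
    rw [evolved, poissonSemigroup, ← tsum_mul_left]
    exact tsum_congr fun n => by unfold poissonWeight; ring
  have h1 : HasDerivAt (fun s : ℝ => T - s) (-1) s := by
    simpa using (hasDerivAt_id s).const_sub T
  have h2 : HasDerivAt (fun s : ℝ => Real.exp (-(T - s))) (Real.exp (-(T - s))) s := by
    simpa using h1.neg.exp
  have h3 := HasDerivAt.comp s (h₂ := fun y : ℝ => ∑' n : ℕ, f (k + n) * (y ^ n / n.factorial))
    (hasDerivAt_shift_tsum hT hf hs k hs0) h1
  have h4 := h2.mul h3
  have h5 : (fun s => evolved T f s k) = fun s : ℝ => Real.exp (-(T - s)) *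
      ∑' n : ℕ, f (k + n) * ((T - s) ^ n / n.factorial) := funext fun s => heq s k
  rw [h5]
  convert! h4 using 1
  rw [heq, heq]
  simp only [Function.comp]
  ring

lemma continuousOn_evolved (hT : 0 < T) (hf : ∀ k, 0 < f k)
    (hs : Summable fun k => f k * poissonWeight T k) (k : ℕ) :
    ContinuousOn (fun s => evolved T f s k) (Ioc 0 T) := fun _ hs0 =>
  (hasDerivAt_evolved hT hf hs k (abs_sub_lt_of_mem_Ioc hs0)).continuousAt.continuousWithinAt

lemma evolved_self (T : ℝ) (f : ℕ → ℝ) (k : ℕ) : evolved T f T k = f k := by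
  rw [evolved, sub_self, poissonSemigroup, tsum_eq_single 0]
  · simp [poissonWeight]
  · intro n hn
    simp [poissonWeight, hn]

lemma ofReal_evolved (hT : 0 < T) (hf : ∀ k, 0 < f k)
    (hs : Summable fun k => f k * poissonWeight T k) (k : ℕ) {s : ℝ} (hs0 : s ∈ Ioc 0 T) :
    ENNReal.ofReal (evolved T f s k)
      = ∑' n, ENNReal.ofReal (f (k + n)) * ENNReal.ofReal (poissonWeight (T - s) n) := by
  rw [evolved, poissonSemigroup, ENNReal.ofReal_tsum_of_nonneg
    (fun n => mul_nonneg (hf _).le (poissonWeight_nonneg (by linarith [hs0.2]) _))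
    (summable_evolved hT hf hs k (abs_sub_lt_of_mem_Ioc hs0))]
  exact tsum_congr fun n => ENNReal.ofReal_mul (hf _).le

/-- `P_{T-s} f` is a probability density with respect to `π_s`. -/
lemma tsum_evolved_mul_poissonWeight (hT : 0 < T) (hf : ∀ k, 0 < f k)
    (hf_one : HasSum (fun k => f k * poissonWeight T k) 1) {s : ℝ} (hs0 : s ∈ Ioc 0 T) :
    ∑' k, ENNReal.ofReal (evolved T f s k * poissonWeight s k) = 1 := by
  have h := tsum_tsum_poissonWeight hs0.1.le (sub_nonneg.2 hs0.2) fun m => ENNReal.ofReal (f m)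
  simp_rw [← ofReal_evolved hT hf hf_one.summable _ hs0] at h
  simp_rw [ENNReal.ofReal_mul (evolved_pos hT hf hf_one.summable _ hs0).le]
  rw [h, add_sub_cancel]
  simp_rw [← ENNReal.ofReal_mul (hf _).le]
  rw [← ENNReal.ofReal_tsum_of_nonneg
    (fun n => mul_nonneg (hf _).le (poissonWeight_nonneg hT.le _)) hf_one.summable,
    hf_one.tsum_eq, ENNReal.ofReal_one]

lemma hasSum_evolved_mul_poissonWeight (hT : 0 < T) (hf : ∀ k, 0 < f k)
    (hf_one : HasSum (fun k => f k * poissonWeight T k) 1) {s : ℝ} (hs0 : s ∈ Ioc 0 T) :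
    HasSum (fun k => evolved T f s k * poissonWeight s k) 1 := by
  have h := tsum_evolved_mul_poissonWeight hT hf hf_one hs0
  have hnn : ∀ k, 0 ≤ evolved T f s k * poissonWeight s k := fun k =>
    mul_nonneg (evolved_pos hT hf hf_one.summable k hs0).le (poissonWeight_nonneg hs0.1.le k)
  have hsum : Summable fun k => evolved T f s k * poissonWeight s k :=
    (ENNReal.summable_toReal (by rw [h]; simp)).congr fun k => ENNReal.toReal_ofReal (hnn k)
  rw [← ENNReal.ofReal_tsum_of_nonneg hnn hsum, ENNReal.ofReal_eq_one] at h
  exact h ▸ hsum.hasSum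

lemma div_succ_mem_Ioc (hT : 0 < T) (n : ℕ) : T / ((n : ℝ) + 1) ∈ Ioc 0 T :=
  ⟨by positivity, div_le_self hT.le (by linarith [n.cast_nonneg (α := ℝ)])⟩

lemma tendsto_div_succ (hT : 0 < T) :
    Tendsto (fun n : ℕ => T / ((n : ℝ) + 1)) atTop (𝓝[>] 0) := by
  have h := (tendsto_one_div_add_atTop_nhds_zero_nat (𝕜 := ℝ)).const_mul T
  rw [mul_zero] at h
  exact tendsto_nhdsWithin_iff.2 ⟨h.congr fun n => mul_one_div T _,
    Eventually.of_forall fun n => (div_succ_mem_Ioc hT n).1⟩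

lemma poissonWeight_sub_le {r : ℝ} (hr : 0 ≤ r) (hrT : r ≤ T) (n : ℕ) :
    poissonWeight (T - r) n ≤ Real.exp T * poissonWeight T n := by
  unfold poissonWeight
  rw [mul_div_assoc, mul_div_assoc, ← mul_assoc, ← Real.exp_add, add_neg_cancel, Real.exp_zero]
  have h0 : 0 ≤ T - r := by linarith
  gcongr
  · exact Real.exp_le_one_iff.2 (by linarith)
  · linarith

lemma summable_poissonWeight_sub {g : ℕ → ℝ} (hg : ∀ k, 0 ≤ g k)
    (hs : Summable fun k => g k * poissonWeight T k) {r : ℝ} (hr : 0 ≤ r) (hrT : r ≤ T) :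
    Summable fun k => g k * poissonWeight (T - r) k := by
  refine Summable.of_nonneg_of_le
    (fun k => mul_nonneg (hg k) (poissonWeight_nonneg (by linarith) k)) (fun k => ?_)
    (hs.mul_left (Real.exp T))
  rw [mul_left_comm]
  exact mul_le_mul_of_nonneg_left (poissonWeight_sub_le hr hrT k) (hg k)

/-- `P_{T-r} g(0) → P_T g(0)` as `r → 0`, for nonnegative `π_T`-summable `g`. -/
lemma tendsto_tsum_poissonWeight {g : ℕ → ℝ} (hT : 0 < T) (hg : ∀ k, 0 ≤ g k)
    (hs : Summable fun k => g k * poissonWeight T k) :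
    Tendsto (fun r => ∑' n, g n * poissonWeight (T - r) n) (𝓝[>] 0)
      (𝓝 (∑' n, g n * poissonWeight T n)) := by
  refine tendsto_tsum_of_dominated_convergence
    (bound := fun n => Real.exp T * (g n * poissonWeight T n)) (hs.mul_left _) (fun n => ?_) ?_
  · have h : Tendsto (fun r : ℝ => poissonWeight (T - r) n) (𝓝 0) (𝓝 (poissonWeight (T - 0) n)) :=
      ((continuous_poissonWeight n).comp (continuous_const.sub continuous_id)).tendsto 0
    rw [sub_zero] at h
    exact (h.mono_left nhdsWithin_le_nhds).const_mul _
  · filter_upwards [Ioo_mem_nhdsGT hT] with r hr n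
    have h0 : 0 ≤ T - r := by linarith [hr.2]
    rw [Real.norm_of_nonneg (mul_nonneg (hg n) (poissonWeight_nonneg h0 n)), mul_left_comm]
    exact mul_le_mul_of_nonneg_left (poissonWeight_sub_le hr.1.le hr.2.le n) (hg n)

lemma tendsto_evolved_zero (hT : 0 < T) (hf : ∀ k, 0 < f k)
    (hf_one : HasSum (fun k => f k * poissonWeight T k) 1) :
    Tendsto (fun r => evolved T f r 0) (𝓝[>] 0) (𝓝 1) := by
  have h := tendsto_tsum_poissonWeight hT (fun k => (hf k).le) hf_one.summable
  rw [hf_one.tsum_eq] at h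
  simpa [evolved, poissonSemigroup] using h

end Semigroup

/-! ### Evolution of Poisson means -/

/-- The mean `∫ g dπ_s ∈ [0, ∞]` of a nonnegative function. -/
def poissonMean (s : ℝ) (g : ℕ → ℝ) : ℝ≥0∞ :=
  ∑' k, ENNReal.ofReal (g k * poissonWeight s k)

lemma aemeasurable_poissonMean {g : ℝ → ℕ → ℝ} {A : Set ℝ} (hA : MeasurableSet A)
    (hg : ∀ k, ContinuousOn (fun s => g s k) A) :
    AEMeasurable (fun s => poissonMean s (g s)) (volume.restrict A) :=
  AEMeasurable.tsum fun k =>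
    (((hg k).mul (continuous_poissonWeight k).continuousOn).aemeasurable hA).ennreal_ofReal

/-- A summable sequence satisfies `liminf M * a_M = 0`, since the harmonic series diverges. -/
lemma exists_mul_le_of_tsum_ne_top {a : ℕ → ℝ≥0∞} (h : ∑' n, a n ≠ ∞) {ε : ℝ} (hε : 0 < ε)
    (M₀ : ℕ) : ∃ M ≥ M₀, (M : ℝ≥0∞) * a M ≤ ENNReal.ofReal ε := by
  by_contra! hcon
  have hs : Summable fun n => (a n).toReal := ENNReal.summable_toReal h
  have hs' := (summable_nat_add_iff (M₀ + 1)).2 hs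
  refine Real.not_summable_natCast_inv ((summable_nat_add_iff (M₀ + 1)).1
    (Summable.of_nonneg_of_le (fun n => by positivity) (fun n => ?_) (hs'.mul_left ε⁻¹)))
  have h1 := hcon (n + (M₀ + 1)) (by omega)
  have hfin : a (n + (M₀ + 1)) ≠ ∞ := ENNReal.ne_top_of_tsum_ne_top h _
  rw [← ENNReal.ofReal_toReal hfin, ← ENNReal.ofReal_natCast,
    ← ENNReal.ofReal_mul (by positivity), ENNReal.ofReal_lt_ofReal_iff_of_nonneg hε.le] at h1
  have hM : (0 : ℝ) < ((n + (M₀ + 1) : ℕ) : ℝ) := by positivity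
  rw [inv_mul_eq_div, inv_le_iff_one_le_mul₀ hM, div_mul_eq_mul_div, le_div_iff₀ hε]
  linarith

/-- If `∂_s g + D g = κ` with `g, κ ≥ 0`, then `d/ds ∫ g_s dπ_s = ∫ κ_s dπ_s`, in integrated form
and with values in `[0, ∞]`. For the sums truncated at `M` there is in addition an outgoing flux
`g(M) π_s(M-1) ≤ (M / r) g(M) π_s(M)`; integrability in time of `∫ g_s dπ_s` makes it vanish along
a subsequence of values of `M`. -/
theorem poissonMean_eq_add_lintegral {r T : ℝ} (hr : 0 < r) (hrT : r ≤ T) {g κ : ℝ → ℕ → ℝ}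
    (hg : ∀ s ∈ Icc r T, ∀ k, 0 ≤ g s k) (hκ : ∀ s ∈ Icc r T, ∀ k, 0 ≤ κ s k)
    (hd : ∀ s ∈ Icc r T, ∀ k,
      HasDerivAt (fun s => g s k) (κ s k - (g s (k + 1) - g s k)) s)
    (hκc : ∀ k, ContinuousOn (fun s => κ s k) (Icc r T))
    (hfin : ∫⁻ s in Ioc r T, poissonMean s (g s) ≠ ∞) :
    poissonMean T (g T)
      = poissonMean r (g r) + ∫⁻ s in Ioc r T, poissonMean s (κ s) := by
  have hw : ∀ s ∈ Icc r T, ∀ k, 0 ≤ poissonWeight s k := fun s hs k =>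
    poissonWeight_nonneg (hr.le.trans hs.1) k
  have hwp : ∀ s ∈ Icc r T, ∀ k, 0 ≤ poissonWeightPred s k := fun s hs k =>
    poissonWeightPred_nonneg (hr.le.trans hs.1) k
  have hgc : ∀ k, ContinuousOn (fun s => g s k) (Icc r T) := fun k s hs =>
    (hd s hs k).continuousAt.continuousWithinAt
  have hrmem : r ∈ Icc r T := ⟨le_rfl, hrT⟩
  have hTmem : T ∈ Icc r T := ⟨hrT, le_rfl⟩
  let S : ℕ → ℝ → ℝ := fun M s => ∑ k ∈ Finset.range M, g s k * poissonWeight s k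
  let A : ℕ → ℝ → ℝ := fun M s => ∑ k ∈ Finset.range M, κ s k * poissonWeight s k
  let B : ℕ → ℝ → ℝ := fun M s => g s M * poissonWeightPred s M
  have hSd : ∀ M, ∀ s ∈ Icc r T, HasDerivAt (S M) (A M s - B M s) s := by
    intro M s hs
    induction M with
    | zero => simpa [S, A, B, poissonWeightPred] using hasDerivAt_const s (0 : ℝ)
    | succ M ih =>
      have h := ih.add ((hd s hs M).mul (hasDerivAt_poissonWeight s M))
      have hS : S (M + 1) = fun s => S M s + g s M * poissonWeight s M :=
        funext fun s => Finset.sum_range_succ _ _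
      rw [hS]
      convert! h using 1
      simp only [A, B, Finset.sum_range_succ, poissonWeightPred]
      ring
  have hAc : ∀ M, ContinuousOn (A M) (Icc r T) := fun M =>
    continuousOn_finsetSum _ fun k _ => (hκc k).mul (continuous_poissonWeight k).continuousOn
  have hBc : ∀ M, ContinuousOn (B M) (Icc r T) := fun M =>
    (hgc M).mul (continuous_poissonWeightPred M).continuousOn
  have hA0 : ∀ M, ∀ s ∈ Icc r T, 0 ≤ A M s := fun M s hs =>
    Finset.sum_nonneg fun k _ => mul_nonneg (hκ s hs k) (hw s hs k)
  have hB0 : ∀ M, ∀ s ∈ Icc r T, 0 ≤ B M s := fun M s hs =>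
    mul_nonneg (hg s hs M) (hwp s hs M)
  have hS0 : ∀ M, ∀ s ∈ Icc r T, 0 ≤ S M s := fun M s hs =>
    Finset.sum_nonneg fun k _ => mul_nonneg (hg s hs k) (hw s hs k)
  have hlint : ∀ h : ℝ → ℝ, ContinuousOn h (Icc r T) → (∀ s ∈ Icc r T, 0 ≤ h s) →
      0 ≤ ∫ s in r..T, h s ∧
      ENNReal.ofReal (∫ s in r..T, h s) = ∫⁻ s in Ioc r T, ENNReal.ofReal (h s) := by
    intro h hc h0
    refine ⟨intervalIntegral.integral_nonneg hrT h0, ?_⟩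
    rw [intervalIntegral.integral_of_le hrT, ofReal_integral_eq_lintegral_ofReal]
    · exact (hc.integrableOn_Icc).mono_set Ioc_subset_Icc_self
    · exact (ae_restrict_iff' measurableSet_Ioc).2
        (ae_of_all _ fun s hs => h0 s (Ioc_subset_Icc_self hs))
  -- The truncated identity, with the boundary flux moved to the left.
  have htrunc : ∀ M, ENNReal.ofReal (S M T) + ∫⁻ s in Ioc r T, ENNReal.ofReal (B M s)
      = ENNReal.ofReal (S M r) + ∫⁻ s in Ioc r T, ENNReal.ofReal (A M s) := by
    intro M
    have hftc := intervalIntegral.integral_eq_sub_of_hasDerivAt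
      (f := S M) (f' := fun s => A M s - B M s) (a := r) (b := T)
      (fun s hs => hSd M s (by rwa [uIcc_of_le hrT] at hs))
      (((hAc M).sub (hBc M)).intervalIntegrable_of_Icc hrT)
    rw [intervalIntegral.integral_sub ((hAc M).intervalIntegrable_of_Icc hrT)
      ((hBc M).intervalIntegrable_of_Icc hrT)] at hftc
    obtain ⟨hA1, hA2⟩ := hlint _ (hAc M) (hA0 M)
    obtain ⟨hB1, hB2⟩ := hlint _ (hBc M) (hB0 M)
    rw [← hA2, ← hB2, ← ENNReal.ofReal_add (hS0 M T hTmem) hB1,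
      ← ENNReal.ofReal_add (hS0 M r hrmem) hA1]
    congr 1
    linarith
  have hmean : ∀ s ∈ Icc r T, poissonMean s (g s) = ⨆ M, ENNReal.ofReal (S M s) := by
    intro s hs
    rw [poissonMean, ENNReal.tsum_eq_iSup_nat]
    exact iSup_congr fun M => (ENNReal.ofReal_sum_of_nonneg fun k _ =>
      mul_nonneg (hg s hs k) (hw s hs k)).symm
  have hSmono : ∀ s ∈ Icc r T, Monotone fun M => ENNReal.ofReal (S M s) := fun s hs M M' h =>
    ENNReal.ofReal_le_ofReal (Finset.sum_le_sum_of_subset_of_nonneg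
      (Finset.range_mono h) fun k _ _ => mul_nonneg (hg s hs k) (hw s hs k))
  have hAmono : Monotone fun M => ∫⁻ s in Ioc r T, ENNReal.ofReal (A M s) := fun M M' h =>
    setLIntegral_mono_ae' measurableSet_Ioc (ae_of_all _ fun s hs' => by
      have hs := Ioc_subset_Icc_self hs'
      exact ENNReal.ofReal_le_ofReal (Finset.sum_le_sum_of_subset_of_nonneg
        (Finset.range_mono h) fun k _ _ => mul_nonneg (hκ s hs k) (hw s hs k)))
  have hmeas : ∀ {h : ℝ → ℝ}, ContinuousOn h (Icc r T) →
      AEMeasurable (fun s => ENNReal.ofReal (h s)) (volume.restrict (Ioc r T)) := fun hc =>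
    ((hc.mono Ioc_subset_Icc_self).aemeasurable measurableSet_Ioc).ennreal_ofReal
  have hκw : ∀ k, ContinuousOn (fun s => κ s k * poissonWeight s k) (Icc r T) := fun k =>
    (hκc k).mul (continuous_poissonWeight k).continuousOn
  have hgw : ∀ k, ContinuousOn (fun s => g s k * poissonWeight s k) (Icc r T) := fun k =>
    (hgc k).mul (continuous_poissonWeight k).continuousOn
  have hint : ∫⁻ s in Ioc r T, poissonMean s (κ s)
      = ⨆ M, ∫⁻ s in Ioc r T, ENNReal.ofReal (A M s) := by
    simp only [poissonMean]
    rw [lintegral_tsum fun k => hmeas (hκw k), ENNReal.tsum_eq_iSup_nat]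
    refine iSup_congr fun M => ?_
    rw [← lintegral_finsetSum' _ fun k _ => hmeas (hκw k)]
    refine setLIntegral_congr_fun measurableSet_Ioc fun s hs' => ?_
    have hs := Ioc_subset_Icc_self hs'
    exact (ENNReal.ofReal_sum_of_nonneg fun k _ => mul_nonneg (hκ s hs k) (hw s hs k)).symm
  rw [hmean r hrmem, hint, ENNReal.iSup_add_iSup_of_monotone (hSmono r hrmem) hAmono]
  refine le_antisymm ?_ (iSup_le fun M₀ => ?_)
  · rw [hmean T hTmem]
    exact iSup_mono fun M => (htrunc M) ▸ le_self_add
  · refine ENNReal.le_of_forall_pos_le_add fun ε hε _ => ?_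
    have hsum : ∑' M, ∫⁻ s in Ioc r T, ENNReal.ofReal (g s M * poissonWeight s M) ≠ ∞ := by
      rwa [← lintegral_tsum fun k => hmeas (hgw k)]
    obtain ⟨M, hM, hMa⟩ := exists_mul_le_of_tsum_ne_top hsum (mul_pos hr hε) M₀
    have hflux : ∫⁻ s in Ioc r T, ENNReal.ofReal (B M s) ≤ ε := by
      have h1 : ∀ s ∈ Ioc r T, ENNReal.ofReal (B M s)
          ≤ ENNReal.ofReal r⁻¹ * (M * ENNReal.ofReal (g s M * poissonWeight s M)) := by
        intro s hs'
        have hs := Ioc_subset_Icc_self hs'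
        rw [← ENNReal.ofReal_natCast, ← ENNReal.ofReal_mul (by positivity),
          ← ENNReal.ofReal_mul (by positivity)]
        refine ENNReal.ofReal_le_ofReal ?_
        have h2 := mul_poissonWeightPred s M
        have h3 : r * poissonWeightPred s M ≤ M * poissonWeight s M := by
          rw [← h2]; exact mul_le_mul_of_nonneg_right hs.1 (hwp s hs M)
        have h4 := mul_le_mul_of_nonneg_left h3 (hg s hs M)
        rw [inv_mul_eq_div, le_div_iff₀ hr]
        simp only [B]
        linarith
      calc ∫⁻ s in Ioc r T, ENNReal.ofReal (B M s)
          ≤ ∫⁻ s in Ioc r T, ENNReal.ofReal r⁻¹ *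
              (M * ENNReal.ofReal (g s M * poissonWeight s M)) :=
            setLIntegral_mono_ae' measurableSet_Ioc (ae_of_all _ h1)
        _ = ENNReal.ofReal r⁻¹ * (M *
              ∫⁻ s in Ioc r T, ENNReal.ofReal (g s M * poissonWeight s M)) := by
            rw [lintegral_const_mul' _ _ ENNReal.ofReal_ne_top,
              lintegral_const_mul' _ _ (ENNReal.natCast_ne_top M)]
        _ ≤ ENNReal.ofReal r⁻¹ * ENNReal.ofReal (r * ε) :=
            mul_le_mul_right hMa _
        _ = ε := by
            rw [← ENNReal.ofReal_mul (by positivity), inv_mul_cancel_left₀ hr.ne',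
              ENNReal.ofReal_coe_nnreal]
    calc _ ≤ ENNReal.ofReal (S M r) + ∫⁻ s in Ioc r T, ENNReal.ofReal (A M s) :=
          add_le_add (hSmono r hrmem hM) (hAmono hM)
      _ = ENNReal.ofReal (S M T) + ∫⁻ s in Ioc r T, ENNReal.ofReal (B M s) := (htrunc M).symm
      _ ≤ poissonMean T (g T) + ε :=
          add_le_add ((le_iSup (fun M => ENNReal.ofReal (S M T)) M).trans_eq
            (hmean T hTmem).symm) hflux

/-! ### Entropy and its first two time derivatives -/

/-- The Bregman divergence `b log (b/a) - b + a` of `x log x`: the integrand of the time derivative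
of the entropy, at consecutive values `a, b` of the density. -/
def entropyRate (a b : ℝ) : ℝ := b * Real.log (b / a) - b + a

/-- The integrand `(b²/a) (α log α - α + 1)`, `α = ca/b²`, of the second time derivative of the
entropy, at consecutive values `a, b, c` of the density. -/
def entropyRateDeriv (a b c : ℝ) : ℝ := b ^ 2 / a * klFun (c * a / b ^ 2)

lemma entropyRate_nonneg {a b : ℝ} (ha : 0 < a) (hb : 0 < b) : 0 ≤ entropyRate a b := by
  have h := mul_nonneg ha.le (klFun_nonneg (div_nonneg hb.le ha.le))
  have : a * klFun (b / a) = entropyRate a b := by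
    unfold klFun entropyRate
    field_simp
    ring
  rwa [this] at h

lemma entropyRateDeriv_nonneg {a b c : ℝ} (ha : 0 < a) (hb : 0 < b) (hc : 0 < c) :
    0 ≤ entropyRateDeriv a b c :=
  mul_nonneg (by positivity) (klFun_nonneg (by positivity))

section Entropy

variable {T : ℝ} {f : ℕ → ℝ}

/-- Jensen's inequality `φ(P_{T-s} f) ≤ P_{T-s} φ(f)` for `φ = klFun`. -/
lemma klFun_evolved_le (hT : 0 < T) (hf : ∀ k, 0 < f k)
    (hs : Summable fun k => f k * poissonWeight T k) (k : ℕ) {s : ℝ} (hs0 : s ∈ Ioc 0 T) :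
    ENNReal.ofReal (klFun (evolved T f s k))
      ≤ ∑' n, ENNReal.ofReal (klFun (f (k + n))) * ENNReal.ofReal (poissonWeight (T - s) n) := by
  set a := evolved T f s k with ha_def
  have ha : 0 < a := evolved_pos hT hf hs k hs0
  have hw : ∀ n, 0 ≤ poissonWeight (T - s) n := poissonWeight_nonneg (by linarith [hs0.2])
  simp_rw [← ENNReal.ofReal_mul (klFun_nonneg (hf _).le)]
  have hnn : ∀ n, 0 ≤ klFun (f (k + n)) * poissonWeight (T - s) n := fun n =>
    mul_nonneg (klFun_nonneg (hf _).le) (hw n)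
  by_cases hsum : Summable fun n => klFun (f (k + n)) * poissonWeight (T - s) n
  · rw [← ENNReal.ofReal_tsum_of_nonneg hnn hsum]
    refine ENNReal.ofReal_le_ofReal ?_
    -- Integrate the tangent line inequality at the mean value `a`.
    have htan : ∀ x, 0 < x → klFun a + Real.log a * (x - a) ≤ klFun x := by
      intro x hx
      have h := entropyRate_nonneg ha hx
      rw [entropyRate, Real.log_div hx.ne' ha.ne'] at h
      unfold klFun
      linarith
    have hf1 := (summable_evolved hT hf hs k (abs_sub_lt_of_mem_Ioc hs0)).hasSum
    have hlin : HasSum (fun n => (klFun a + Real.log a * (f (k + n) - a)) *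
        poissonWeight (T - s) n) (klFun a) := by
      have h := ((hasSum_poissonWeight (T - s)).mul_left (klFun a - Real.log a * a)).add
        (hf1.mul_left (Real.log a))
      rw [show (∑' n, f (k + n) * poissonWeight (T - s) n) = a from rfl] at h
      convert! h using 1
      · ext n; ring
      · ring
    exact hasSum_le (fun n => mul_le_mul_of_nonneg_right (htan _ (hf _)) (hw n)) hlin hsum.hasSum
  · have : ∑' n, ENNReal.ofReal (klFun (f (k + n)) * poissonWeight (T - s) n) = ∞ := by
      by_contra hne
      exact hsum ((ENNReal.summable_toReal hne).congr fun n => ENNReal.toReal_ofReal (hnn n))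
    rw [this]
    exact le_top

/-- The entropy `∫ φ(P_{T-s} f) dπ_s`, with `φ = klFun`, at time `s`. -/
def entropyAt (T : ℝ) (f : ℕ → ℝ) (s : ℝ) : ℝ≥0∞ :=
  poissonMean s fun k => klFun (evolved T f s k)

/-- The entropy production `∫ Ψ(P_{T-s} f, P_{T-s} f(· + 1)) dπ_s`, with `Ψ = entropyRate`, at
time `s`. -/
def entropyRateAt (T : ℝ) (f : ℕ → ℝ) (s : ℝ) : ℝ≥0∞ :=
  poissonMean s fun k => entropyRate (evolved T f s k) (evolved T f s (k + 1))

/-- The second time derivative of the entropy at time `s`. -/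
def entropyRateDerivAt (T : ℝ) (f : ℕ → ℝ) (s : ℝ) : ℝ≥0∞ :=
  poissonMean s fun k =>
    entropyRateDeriv (evolved T f s k) (evolved T f s (k + 1)) (evolved T f s (k + 2))

lemma entropyAt_self (hf : ∀ k, 0 < f k) : entropyAt T f T =
    ∑' m, ENNReal.ofReal (klFun (f m)) * ENNReal.ofReal (poissonWeight T m) := by
  unfold entropyAt poissonMean
  simp only [evolved_self]
  exact tsum_congr fun m => ENNReal.ofReal_mul (klFun_nonneg (hf m).le)

lemma ofReal_klFun_evolved_mul_le (hT : 0 < T) (hf : ∀ k, 0 < f k)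
    (hs : Summable fun k => f k * poissonWeight T k) (k : ℕ) {s : ℝ} (hs0 : s ∈ Ioc 0 T) :
    ENNReal.ofReal (klFun (evolved T f s k) * poissonWeight s k) ≤
      (∑' n, ENNReal.ofReal (klFun (f (k + n))) * ENNReal.ofReal (poissonWeight (T - s) n)) *
        ENNReal.ofReal (poissonWeight s k) := by
  rw [ENNReal.ofReal_mul (klFun_nonneg (evolved_pos hT hf hs k hs0).le)]
  gcongr
  exact klFun_evolved_le hT hf hs k hs0

/-- The entropy decreases along the semigroup. -/
lemma entropyAt_le (hT : 0 < T) (hf : ∀ k, 0 < f k)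
    (hs : Summable fun k => f k * poissonWeight T k) {s : ℝ} (hs0 : s ∈ Ioc 0 T) :
    entropyAt T f s ≤ entropyAt T f T := by
  have h := tsum_tsum_poissonWeight hs0.1.le (sub_nonneg.2 hs0.2)
    fun m => ENNReal.ofReal (klFun (f m))
  rw [add_sub_cancel] at h
  rw [entropyAt_self hf, ← h]
  exact ENNReal.tsum_le_tsum fun k => ofReal_klFun_evolved_mul_le hT hf hs k hs0

lemma hasSum_klFun (hf_one : HasSum (fun k => f k * poissonWeight T k) 1)
    (hf_ent : Summable (fun k => f k * Real.log (f k) * poissonWeight T k)) :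
    HasSum (fun k => klFun (f k) * poissonWeight T k) (entropy T f) := by
  have h := (hf_ent.hasSum.add (hasSum_poissonWeight T)).sub hf_one
  convert! h using 1
  · ext k; unfold klFun; ring
  · rw [entropy, hf_one.tsum_eq, Real.log_one]; ring

lemma entropy_nonneg (hT : 0 < T) (hf : ∀ k, 0 < f k)
    (hf_one : HasSum (fun k => f k * poissonWeight T k) 1)
    (hf_ent : Summable (fun k => f k * Real.log (f k) * poissonWeight T k)) :
    0 ≤ entropy T f :=
  (hasSum_klFun hf_one hf_ent).nonneg fun k =>
    mul_nonneg (klFun_nonneg (hf k).le) (poissonWeight_nonneg hT.le k)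

lemma entropyAt_self_eq (hT : 0 < T) (hf : ∀ k, 0 < f k)
    (hf_one : HasSum (fun k => f k * poissonWeight T k) 1)
    (hf_ent : Summable (fun k => f k * Real.log (f k) * poissonWeight T k)) :
    entropyAt T f T = ENNReal.ofReal (entropy T f) := by
  have h := hasSum_klFun hf_one hf_ent
  unfold entropyAt poissonMean
  simp only [evolved_self]
  rw [← h.tsum_eq, ENNReal.ofReal_tsum_of_nonneg (fun k =>
    mul_nonneg (klFun_nonneg (hf k).le) (poissonWeight_nonneg hT.le k)) h.summable]

/-- At time `0` the density is concentrated at the single state `0`, where it is `1`: the entropy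
tends to `0`. The states `k ≥ 1` contribute at most the part of `∫ φ(f) dπ_T` which Jensen's
inequality does not assign to the state `0`. -/
lemma tendsto_entropyAt_zero (hT : 0 < T) (hf : ∀ k, 0 < f k)
    (hf_one : HasSum (fun k => f k * poissonWeight T k) 1)
    (hf_ent : Summable (fun k => f k * Real.log (f k) * poissonWeight T k)) :
    Tendsto (entropyAt T f) (𝓝[>] 0) (𝓝 0) := by
  have hkl := hasSum_klFun hf_one hf_ent
  have hnn : ∀ k, 0 ≤ klFun (f k) := fun k => klFun_nonneg (hf k).le
  have hE := entropyAt_self_eq hT hf hf_one hf_ent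
  set J : ℝ → ℝ := fun r => (∑' n, klFun (f n) * poissonWeight (T - r) n) * Real.exp (-r) with hJ
  have hexp : Tendsto (fun r : ℝ => Real.exp (-r)) (𝓝[>] 0) (𝓝 1) := by
    have h : Tendsto (fun r : ℝ => Real.exp (-r)) (𝓝 0) (𝓝 (Real.exp (-0))) :=
      (Real.continuous_exp.comp continuous_neg).tendsto 0
    rw [neg_zero, Real.exp_zero] at h
    exact h.mono_left nhdsWithin_le_nhds
  have hJt : Tendsto J (𝓝[>] 0) (𝓝 (entropy T f)) := by
    have h := (tendsto_tsum_poissonWeight hT hnn hkl.summable).mul hexp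
    rwa [hkl.tsum_eq, mul_one] at h
  have h0t : Tendsto (fun r => klFun (evolved T f r 0) * Real.exp (-r)) (𝓝[>] 0) (𝓝 0) := by
    have h := ((continuous_klFun.tendsto 1).comp (tendsto_evolved_zero hT hf hf_one)).mul hexp
    rwa [klFun_one, zero_mul] at h
  have hbound : ∀ r ∈ Ioc 0 T, entropyAt T f r ≤
      ENNReal.ofReal (klFun (evolved T f r 0) * Real.exp (-r)) +
        ENNReal.ofReal (entropy T f - J r) := by
    intro r hr
    have hsg := tsum_tsum_poissonWeight hr.1.le (sub_nonneg.2 hr.2)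
      fun m => ENNReal.ofReal (klFun (f m))
    rw [add_sub_cancel, ← entropyAt_self hf, hE, tsum_eq_zero_add' ENNReal.summable,
      poissonWeight_zero] at hsg
    have hJr : (∑' n, ENNReal.ofReal (klFun (f (0 + n))) *
        ENNReal.ofReal (poissonWeight (T - r) n)) * ENNReal.ofReal (Real.exp (-r))
        = ENNReal.ofReal (J r) := by
      simp_rw [zero_add, ← ENNReal.ofReal_mul (hnn _)]
      rw [← ENNReal.ofReal_tsum_of_nonneg
        (fun n => mul_nonneg (hnn n) (poissonWeight_nonneg (sub_nonneg.2 hr.2) n))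
        (summable_poissonWeight_sub hnn hkl.summable hr.1.le hr.2),
        ← ENNReal.ofReal_mul (tsum_nonneg fun n =>
          mul_nonneg (hnn n) (poissonWeight_nonneg (sub_nonneg.2 hr.2) n))]
    have hJ0 : 0 ≤ J r := mul_nonneg (tsum_nonneg fun n =>
      mul_nonneg (hnn n) (poissonWeight_nonneg (sub_nonneg.2 hr.2) n)) (Real.exp_pos _).le
    rw [hJr] at hsg
    unfold entropyAt poissonMean
    rw [tsum_eq_zero_add' ENNReal.summable, poissonWeight_zero]
    gcongr
    rw [ENNReal.ofReal_sub _ hJ0, ← hsg, ENNReal.add_sub_cancel_left ENNReal.ofReal_ne_top]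
    exact ENNReal.tsum_le_tsum fun k => ofReal_klFun_evolved_mul_le hT hf hf_one.summable (k + 1) hr
  have hlim := (ENNReal.tendsto_ofReal h0t).add
    (ENNReal.tendsto_ofReal ((tendsto_const_nhds (x := entropy T f)).sub hJt))
  simp only [sub_self, ENNReal.ofReal_zero, add_zero] at hlim
  refine tendsto_of_tendsto_of_tendsto_of_le_of_le' tendsto_const_nhds hlim
    (Eventually.of_forall fun _ => zero_le) ?_
  filter_upwards [Ioc_mem_nhdsGT hT] with r hr using hbound r hr

lemma continuousOn_entropyRate (hT : 0 < T) (hf : ∀ k, 0 < f k)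
    (hs : Summable fun k => f k * poissonWeight T k) (k : ℕ) :
    ContinuousOn (fun s => entropyRate (evolved T f s k) (evolved T f s (k + 1))) (Ioc 0 T) := by
  have h0 := continuousOn_evolved hT hf hs k
  have h1 := continuousOn_evolved hT hf hs (k + 1)
  exact ((h1.mul ((h1.div h0 fun s hs0 => (evolved_pos hT hf hs k hs0).ne').log fun s hs0 =>
    (div_pos (evolved_pos hT hf hs _ hs0) (evolved_pos hT hf hs _ hs0)).ne')).sub h1).add h0

lemma continuousOn_entropyRateDeriv (hT : 0 < T) (hf : ∀ k, 0 < f k)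
    (hs : Summable fun k => f k * poissonWeight T k) (k : ℕ) :
    ContinuousOn (fun s => entropyRateDeriv (evolved T f s k) (evolved T f s (k + 1))
      (evolved T f s (k + 2))) (Ioc 0 T) := by
  have h0 := continuousOn_evolved hT hf hs k
  have h1 := continuousOn_evolved hT hf hs (k + 1)
  have h2 := continuousOn_evolved hT hf hs (k + 2)
  exact ((h1.pow 2).div h0 fun s hs0 => (evolved_pos hT hf hs k hs0).ne').mul
    (continuous_klFun.comp_continuousOn ((h2.mul h0).div (h1.pow 2) fun s hs0 =>
      (pow_pos (evolved_pos hT hf hs (k + 1) hs0) 2).ne'))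

lemma entropyAt_self_eq_add (hT : 0 < T) (hf : ∀ k, 0 < f k)
    (hf_one : HasSum (fun k => f k * poissonWeight T k) 1)
    (hf_ent : Summable (fun k => f k * Real.log (f k) * poissonWeight T k))
    {r : ℝ} (hr : r ∈ Ioc 0 T) :
    entropyAt T f T = entropyAt T f r + ∫⁻ s in Ioc r T, entropyRateAt T f s := by
  have hs := hf_one.summable
  have hsub : Icc r T ⊆ Ioc 0 T := fun s h => ⟨hr.1.trans_le h.1, h.2⟩
  refine poissonMean_eq_add_lintegral (g := fun s k => klFun (evolved T f s k))
    (κ := fun s k => entropyRate (evolved T f s k) (evolved T f s (k + 1))) hr.1 hr.2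
    (fun s h k => klFun_nonneg (evolved_pos hT hf hs k (hsub h)).le)
    (fun s h k => entropyRate_nonneg (evolved_pos hT hf hs k (hsub h))
      (evolved_pos hT hf hs (k + 1) (hsub h)))
    (fun s h k => ?_) (fun k => (continuousOn_entropyRate hT hf hs k).mono hsub) ?_
  · have h0 := evolved_pos hT hf hs k (hsub h)
    have h1 := evolved_pos hT hf hs (k + 1) (hsub h)
    have hd := (hasDerivAt_klFun h0.ne').comp s
      (hasDerivAt_evolved hT hf hs k (abs_sub_lt_of_mem_Ioc (hsub h)))
    convert! hd using 1
    rw [entropyRate, Real.log_div h1.ne' h0.ne']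
    unfold klFun
    ring
  · refine ((setLIntegral_mono_ae' (g := fun _ => entropyAt T f T) measurableSet_Ioc
      (ae_of_all _ fun s h => entropyAt_le hT hf hs ⟨hr.1.trans h.1, h.2⟩)).trans_lt ?_).ne
    rw [setLIntegral_const, entropyAt_self_eq hT hf hf_one hf_ent, Real.volume_Ioc]
    exact ENNReal.mul_lt_top ENNReal.ofReal_lt_top ENNReal.ofReal_lt_top

/-- The entropy is the time integral of the entropy production. -/
lemma lintegral_entropyRateAt (hT : 0 < T) (hf : ∀ k, 0 < f k)
    (hf_one : HasSum (fun k => f k * poissonWeight T k) 1)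
    (hf_ent : Summable (fun k => f k * Real.log (f k) * poissonWeight T k)) :
    ∫⁻ s in Ioc 0 T, entropyRateAt T f s = ENNReal.ofReal (entropy T f) := by
  rw [← entropyAt_self_eq hT hf hf_one hf_ent]
  have hr := div_succ_mem_Ioc hT
  have hr0 := tendsto_div_succ hT
  refine le_antisymm ?_ ?_
  · have hU : Ioc 0 T = ⋃ n : ℕ, Ioc (T / (n + 1)) T := by
      ext x
      simp only [mem_Ioc, mem_iUnion]
      constructor
      · rintro ⟨h0, h1⟩
        have hev := (tendsto_nhds_of_tendsto_nhdsWithin hr0).eventually_lt_const h0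
        obtain ⟨n, hn⟩ := hev.exists
        exact ⟨n, hn, h1⟩
      · rintro ⟨n, h0, h1⟩
        exact ⟨(hr n).1.trans h0, h1⟩
    have hmono : Monotone fun n : ℕ => Ioc (T / ((n : ℝ) + 1)) T := fun m n h =>
      Ioc_subset_Ioc_left (by gcongr)
    rw [← withDensity_apply _ measurableSet_Ioc, hU, hmono.measure_iUnion]
    refine iSup_le fun n => ?_
    rw [withDensity_apply _ measurableSet_Ioc, entropyAt_self_eq_add hT hf hf_one hf_ent (hr n)]
    exact le_add_self
  · have hlim := ((tendsto_entropyAt_zero hT hf hf_one hf_ent).comp hr0).add_const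
      (∫⁻ s in Ioc 0 T, entropyRateAt T f s)
    rw [zero_add] at hlim
    refine ge_of_tendsto' hlim fun n => ?_
    rw [entropyAt_self_eq_add hT hf hf_one hf_ent (hr n)]
    exact add_le_add le_rfl (lintegral_mono_set (Ioc_subset_Ioc_left (hr n).1.le))

lemma entropyRateAt_self_eq_add (hT : 0 < T) (hf : ∀ k, 0 < f k)
    (hf_one : HasSum (fun k => f k * poissonWeight T k) 1)
    (hf_ent : Summable (fun k => f k * Real.log (f k) * poissonWeight T k))
    {t : ℝ} (ht : t ∈ Ioc 0 T) :
    entropyRateAt T f T = entropyRateAt T f t + ∫⁻ s in Ioc t T, entropyRateDerivAt T f s := by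
  have hs := hf_one.summable
  have hsub : Icc t T ⊆ Ioc 0 T := fun s h => ⟨ht.1.trans_le h.1, h.2⟩
  refine poissonMean_eq_add_lintegral
    (g := fun s k => entropyRate (evolved T f s k) (evolved T f s (k + 1)))
    (κ := fun s k => entropyRateDeriv (evolved T f s k) (evolved T f s (k + 1))
      (evolved T f s (k + 2))) ht.1 ht.2
    (fun s h k => entropyRate_nonneg (evolved_pos hT hf hs k (hsub h))
      (evolved_pos hT hf hs (k + 1) (hsub h)))
    (fun s h k => entropyRateDeriv_nonneg (evolved_pos hT hf hs k (hsub h))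
      (evolved_pos hT hf hs (k + 1) (hsub h)) (evolved_pos hT hf hs (k + 2) (hsub h)))
    (fun s h k => ?_) (fun k => (continuousOn_entropyRateDeriv hT hf hs k).mono hsub) ?_
  · have h0 := evolved_pos hT hf hs k (hsub h)
    have h1 := evolved_pos hT hf hs (k + 1) (hsub h)
    have h2 := evolved_pos hT hf hs (k + 2) (hsub h)
    have hd0 := hasDerivAt_evolved hT hf hs k (abs_sub_lt_of_mem_Ioc (hsub h))
    have hd1 := hasDerivAt_evolved hT hf hs (k + 1) (abs_sub_lt_of_mem_Ioc (hsub h))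
    have hd := ((hd1.mul ((hd1.div hd0 h0.ne').log (div_pos h1 h0).ne')).sub hd1).add hd0
    convert! hd using 1
    simp only [entropyRate, entropyRateDeriv, klFun, Pi.div_apply]
    rw [Real.log_div h1.ne' h0.ne', show k + 1 + 1 = k + 2 from rfl, Real.log_div h2.ne' h1.ne',
      Real.log_div (mul_pos h2 h0).ne' (pow_pos h1 2).ne', Real.log_mul h2.ne' h0.ne',
      Real.log_pow]
    field_simp
    push_cast
    ring
  · have h := lintegral_entropyRateAt hT hf hf_one hf_ent
    exact ((lintegral_mono_set (Ioc_subset_Ioc_left ht.1.le)).trans_lt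
      (h ▸ ENNReal.ofReal_lt_top)).ne

lemma wuFunctional_eq (hf : ∀ k, 0 < f k) :
    wuFunctional T f = ENNReal.ofReal T * entropyRateAt T f T := by
  unfold wuFunctional entropyRateAt poissonMean
  simp only [evolved_self]
  congr 1
  refine tsum_congr fun k => ?_
  congr 2
  have h1 := (hf (k + 1)).ne'
  rw [entropyRate]
  field_simp

/-- Integrating the entropy production identity once more in time. -/
lemma wuFunctional_eq_add (hT : 0 < T) (hf : ∀ k, 0 < f k)
    (hf_one : HasSum (fun k => f k * poissonWeight T k) 1)
    (hf_ent : Summable (fun k => f k * Real.log (f k) * poissonWeight T k)) :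
    wuFunctional T f = ENNReal.ofReal (entropy T f) +
      ∫⁻ t in Ioc 0 T, ∫⁻ s in Ioc t T, entropyRateDerivAt T f s := by
  have hm : AEMeasurable (entropyRateAt T f) (volume.restrict (Ioc 0 T)) :=
    aemeasurable_poissonMean measurableSet_Ioc (continuousOn_entropyRate hT hf hf_one.summable)
  rw [← lintegral_entropyRateAt hT hf hf_one hf_ent, ← lintegral_add_left' hm,
    ← setLIntegral_congr_fun (f := fun _ => entropyRateAt T f T) measurableSet_Ioc
      (fun t ht => entropyRateAt_self_eq_add hT hf hf_one hf_ent ht),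
    setLIntegral_const, Real.volume_Ioc, sub_zero, wuFunctional_eq hf, mul_comm]

/-- The deterministic form of the identity. -/
theorem deficit_eq_lintegral (hT : 0 < T) (hf : ∀ k, 0 < f k)
    (hf_one : HasSum (fun k => f k * poissonWeight T k) 1)
    (hf_ent : Summable (fun k => f k * Real.log (f k) * poissonWeight T k)) :
    deficit T f =
      ((∫⁻ t in Ioc 0 T, ∫⁻ s in Ioc t T, entropyRateDerivAt T f s : ℝ≥0∞) : EReal) := by
  rw [deficit, wuFunctional_eq_add hT hf hf_one hf_ent, EReal.coe_ennreal_add,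
    EReal.coe_ennreal_ofReal, max_eq_left (entropy_nonneg hT hf hf_one hf_ent), add_comm,
    EReal.add_sub_cancel_right]

end Entropy

/-! ### Relative entropy of Poisson measures -/

lemma hasSum_natCast_mul_poissonWeight (t : ℝ) :
    HasSum (fun k : ℕ => (k : ℝ) * poissonWeight t k) t := by
  refine (hasSum_nat_add_iff' 1).1 ?_
  simp only [Finset.range_one, Finset.sum_singleton, Nat.cast_zero, zero_mul, sub_zero]
  have h := (hasSum_poissonWeight t).mul_left t
  rw [mul_one] at h
  exact h.congr_fun fun k => by push_cast; exact succ_mul_poissonWeight_succ t k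

lemma poissonMeasure_eq_withDensity (a : ℝ≥0) :
    poissonMeasure a = (poissonMeasure 1).withDensity
      fun k => ENNReal.ofReal (Real.exp (1 - a) * (a : ℝ) ^ k) := by
  refine Measure.ext_of_singleton fun k => ?_
  rw [withDensity_apply _ (measurableSet_singleton k), lintegral_singleton,
    poissonMeasure_singleton, poissonMeasure_singleton, ← ENNReal.ofReal_mul (by positivity)]
  congr 1
  rw [sub_eq_add_neg, Real.exp_add]
  simp only [NNReal.coe_one, one_pow]
  have : Real.exp 1 * Real.exp (-1) = 1 := by rw [← Real.exp_add]; simp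
  linear_combination (-(Real.exp (-(a : ℝ)) * (a : ℝ) ^ k / k.factorial)) * this

lemma integrable_natCast_poissonMeasure (a : ℝ≥0) :
    Integrable (fun k : ℕ => (k : ℝ)) (poissonMeasure a) := by
  rw [integrable_poissonMeasure_iff]
  refine (hasSum_natCast_mul_poissonWeight a).summable.congr fun k => ?_
  rw [Real.norm_natCast, poissonWeight]
  ring

lemma integral_natCast_poissonMeasure (a : ℝ≥0) : ∫ k : ℕ, (k : ℝ) ∂poissonMeasure a = a := by
  rw [integral_poissonMeasure]
  refine (tsum_congr fun k => ?_).trans (hasSum_natCast_mul_poissonWeight a).tsum_eq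
  rw [smul_eq_mul, poissonWeight]
  ring

lemma klDiv_poissonMeasure_one {a : ℝ≥0} (ha : 0 < a) :
    klDiv (poissonMeasure a) (poissonMeasure 1) = ENNReal.ofReal (klFun a) := by
  have ha' : (0 : ℝ) < a := ha
  have hac : poissonMeasure a ≪ poissonMeasure 1 := by
    rw [poissonMeasure_eq_withDensity a]
    exact withDensity_absolutelyContinuous _ _
  have hrn : (poissonMeasure a).rnDeriv (poissonMeasure 1) =ᵐ[poissonMeasure 1]
      fun k => ENNReal.ofReal (Real.exp (1 - a) * (a : ℝ) ^ k) := by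
    conv_lhs => rw [poissonMeasure_eq_withDensity a]
    exact Measure.rnDeriv_withDensity _ .of_discrete
  have hllr : llr (poissonMeasure a) (poissonMeasure 1) =ᵐ[poissonMeasure a]
      fun k : ℕ => (1 - (a : ℝ)) + Real.log a * k := by
    filter_upwards [hac.ae_le hrn] with k hk
    rw [llr, hk, ENNReal.toReal_ofReal (by positivity),
      Real.log_mul (Real.exp_pos _).ne' (pow_pos ha' k).ne', Real.log_exp, Real.log_pow]
    ring
  have hlin : Integrable (fun k : ℕ => (1 - (a : ℝ)) + Real.log a * k) (poissonMeasure a) :=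
    (integrable_const _).add ((integrable_natCast_poissonMeasure a).const_mul _)
  rw [klDiv_of_ac_of_integrable hac (hlin.congr hllr.symm), integral_congr_ae hllr,
    integral_add (integrable_const _) ((integrable_natCast_poissonMeasure a).const_mul _),
    integral_const_mul, integral_natCast_poissonMeasure]
  simp only [integral_const, probReal_univ, smul_eq_mul, klFun]
  congr 1
  ring

/-- With `a, b, c` consecutive values of the density, `e^{D²F} = ca/b²` and the squared intensity
is `(b/a)²`. -/
lemma ofReal_sq_mul_klDiv_mul {a b c w : ℝ} (ha : 0 < a) (hb : 0 < b) (hc : 0 < c) :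
    ENNReal.ofReal ((b / a) ^ 2) * klDiv (poissonMeasure (Real.toNNReal (Real.exp
        ((Real.log c - Real.log b) - (Real.log b - Real.log a))))) (poissonMeasure 1) *
        ENNReal.ofReal (a * w)
      = ENNReal.ofReal (entropyRateDeriv a b c * w) := by
  have hexp : Real.exp ((Real.log c - Real.log b) - (Real.log b - Real.log a))
      = c * a / b ^ 2 := by
    rw [← Real.log_div hc.ne' hb.ne', ← Real.log_div hb.ne' ha.ne',
      ← Real.log_div (div_pos hc hb).ne' (div_pos hb ha).ne', Real.exp_log (by positivity)]
    field_simp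
  have hpos : 0 < c * a / b ^ 2 := by positivity
  have hkl := klFun_nonneg hpos.le
  rw [hexp, klDiv_poissonMeasure_one (Real.toNNReal_pos.2 hpos), Real.coe_toNNReal _ hpos.le,
    ← ENNReal.ofReal_mul (by positivity), ← ENNReal.ofReal_mul (by positivity), entropyRateDeriv]
  congr 1
  field_simp

/-! ### Independence and measurability for the point process -/

section PointProcess

variable {Ω : Type*} {N : Ω → Measure (ℝ × ℝ)}

lemma pointSigma_mono (N : Ω → Measure (ℝ × ℝ)) {s t : ℝ} (h : s ≤ t) :
    pointSigma N s ≤ pointSigma N t :=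
  iSup_le fun B => le_iSup (fun B : {B : Set (ℝ × ℝ) // MeasurableSet B ∧ B ⊆ Icc 0 t ×ˢ Ici 0} =>
    MeasurableSpace.comap (fun ω => N ω B.1) inferInstance)
    ⟨B.1, B.2.1, B.2.2.trans (prod_mono (Icc_subset_Icc_right h) Subset.rfl)⟩

lemma measurable_pointSigma (N : Ω → Measure (ℝ × ℝ)) {t : ℝ} {B : Set (ℝ × ℝ)}
    (hB : MeasurableSet B) (hBt : B ⊆ Icc 0 t ×ˢ Ici 0) :
    Measurable[pointSigma N t] fun ω => N ω B :=
  Measurable.of_comap_le (le_iSup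
    (fun B : {B : Set (ℝ × ℝ) // MeasurableSet B ∧ B ⊆ Icc 0 t ×ˢ Ici 0} =>
      MeasurableSpace.comap (fun ω => N ω B.1) inferInstance) ⟨B, hB, hBt⟩)

lemma IsPoissonPointProcess.pointSigma_le [mΩ : MeasurableSpace Ω] {ν : Measure (ℝ × ℝ)}
    {P : Measure Ω} (hN : IsPoissonPointProcess N ν P) (t : ℝ) :
    pointSigma N t ≤ mΩ :=
  iSup_le fun B => (hN.measurable_count B.1 B.2.1).comap_le

/-- The atom, inside `D`, of the partition generated by a family `B` of sets, which consists of the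
points with prescribed membership `a` in the sets of the family. -/
def atom {ι : Type*} (B : ι → Set (ℝ × ℝ)) (D : Set (ℝ × ℝ)) (a : ι → Bool) : Set (ℝ × ℝ) :=
  {p | p ∈ D ∧ ∀ i, p ∈ B i ↔ a i = true}

lemma measurableSet_atom {ι : Type*} [Countable ι] {B : ι → Set (ℝ × ℝ)} {D : Set (ℝ × ℝ)}
    (hB : ∀ i, MeasurableSet (B i)) (hD : MeasurableSet D) (a : ι → Bool) :
    MeasurableSet (atom B D a) := by
  have : atom B D a = D ∩ ⋂ i, {p | p ∈ B i ↔ a i = true} := by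
    ext; simp [atom]
  rw [this]
  refine hD.inter (MeasurableSet.iInter fun i => ?_)
  cases a i with
  | false =>
    convert! (hB i).compl using 1
    ext p; simp
  | true =>
    convert! hB i using 1
    ext p; simp

lemma disjoint_atom {ι : Type*} {B : ι → Set (ℝ × ℝ)} {D : Set (ℝ × ℝ)} {a b : ι → Bool}
    (hab : a ≠ b) : Disjoint (atom B D a) (atom B D b) := by
  rw [Set.disjoint_left]
  rintro p ⟨-, ha⟩ ⟨-, hb⟩
  exact hab (funext fun i => Bool.eq_iff_iff.2 ((ha i).symm.trans (hb i)))

lemma biUnion_atom {ι : Type*} [Fintype ι] [DecidableEq ι] {B : ι → Set (ℝ × ℝ)}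
    {D : Set (ℝ × ℝ)} (hBD : ∀ i, B i ⊆ D) (i : ι) :
    ⋃ a ∈ (Finset.univ.filter fun a : ι → Bool => a i = true), atom B D a = B i := by
  classical
  ext p
  simp only [mem_iUnion, Finset.mem_filter, Finset.mem_univ, true_and, exists_prop]
  constructor
  · rintro ⟨a, hai, -, hp⟩
    exact (hp i).2 hai
  · intro hp
    exact ⟨fun j => decide (p ∈ B j), by simpa using hp, hBD i hp, fun j => by simp⟩

/-- The points up to time `t` are independent of the number of points of a set lying outside
`[0, t] × [0, ∞)`. -/
theorem IsPoissonPointProcess.indep_pointSigma [mΩ : MeasurableSpace Ω] {ν : Measure (ℝ × ℝ)}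
    {P : Measure Ω} [IsProbabilityMeasure P]
    (hN : IsPoissonPointProcess N ν P) {t : ℝ} {R : Set (ℝ × ℝ)} (hR : MeasurableSet R)
    (hdisj : Disjoint R (Icc 0 t ×ˢ Ici 0)) :
    Indep (pointSigma N t) (MeasurableSpace.comap (fun ω => N ω R) inferInstance) P := by
  classical
  set D : Set (ℝ × ℝ) := Icc 0 t ×ˢ Ici 0 with hD_def
  have hD : MeasurableSet D := measurableSet_Icc.prod measurableSet_Ici
  let ι := {B : Set (ℝ × ℝ) // MeasurableSet B ∧ B ⊆ D}
  have hsup : pointSigma N t = ⨆ S : Finset ι, ⨆ B ∈ S,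
      MeasurableSpace.comap (fun ω => N ω B.1) inferInstance :=
    iSup_eq_iSup_finset _
  rw [hsup]
  refine indep_iSup_of_monotone (fun S => ?_)
    (fun S => iSup₂_le fun B _ => (hN.measurable_count B.1 B.2.1).comap_le)
    (hN.measurable_count R hR).comap_le
    (fun S S' h => biSup_mono fun B hB => Finset.mem_of_subset h hB)
  let A : Option (S → Bool) → Set (ℝ × ℝ) := fun o => o.elim R (atom (fun B : S => B.1.1) D)
  have hA : ∀ o, MeasurableSet (A o) := by
    rintro (_ | a)
    · exact hR
    · exact measurableSet_atom (fun B : S => B.1.2.1) hD a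
  have hAd : Pairwise fun o o' => Disjoint (A o) (A o') := by
    have hRa : ∀ a, Disjoint R (atom (fun B : S => B.1.1) D a) := fun a =>
      hdisj.mono_right fun p hp => hp.1
    rintro (_ | a) (_ | b) hab
    · exact absurd rfl hab
    · exact hRa b
    · exact (hRa a).symm
    · exact disjoint_atom fun h => hab (congrArg some h)
  have hind : iIndepFun (fun o ω => N ω (A o)) P := by
    let e := Fintype.equivFin (Option (S → Bool))
    have h := hN.indep_count _ (fun i => A (e.symm i)) (fun i => hA _)
      fun i j hij => hAd fun h => hij (e.symm.injective h)
    have h' := h.precomp e.injective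
    simpa using! h'
  have hvec := hind.indepFun_finset (Finset.univ.erase none) {none} (by simp)
    fun o => hN.measurable_count _ (hA o)
  rw [IndepFun_iff_Indep] at hvec
  refine indep_of_indep_of_le_left (indep_of_indep_of_le_right hvec ?_) ?_
  · have hm := (measurable_pi_apply (X := fun _ => ℝ≥0∞)
      (⟨none, by simp⟩ : ({none} : Finset (Option (S → Bool))))).comp
      (comap_measurable fun ω (o : ({none} : Finset (Option (S → Bool)))) => N ω (A o))
    exact Measurable.comap_le hm
  · refine iSup₂_le fun B hB => Measurable.comap_le ?_
    have heq : (fun ω => N ω B.1) = fun ω =>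
        ∑ a ∈ (Finset.univ.filter fun a : S → Bool => a ⟨B, hB⟩ = true), N ω (A (some a)) := by
      funext ω
      rw [← measure_biUnion_finset (fun a _ b _ hab => hAd fun h => hab (Option.some.inj h))
        fun a _ => hA (some a)]
      exact congrArg (N ω) (biUnion_atom (B := fun B : S => B.1.1) (fun B => B.1.2.2) ⟨B, hB⟩).symm
    rw [heq]
    refine Finset.measurable_fun_sum _ fun a _ => ?_
    exact (measurable_pi_apply (X := fun _ => ℝ≥0∞)
      (⟨some a, by simp⟩ : (Finset.univ.erase none : Finset (Option (S → Bool))))).comp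
      (comap_measurable fun ω (o : (Finset.univ.erase none : Finset (Option (S → Bool)))) =>
        N ω (A o))

/-- A predictable process, stopped at the deterministic time `t`, is jointly measurable for
`𝓕_t ⊗ Borel`. -/
lemma measurable_of_predictable {T : ℝ} (hT : 0 ≤ T) {l : ℝ → Ω → ℝ}
    (hl : Measurable[predictableSigma N T] fun p : Icc (0 : ℝ) T × Ω => l (p.1 : ℝ) p.2)
    {t : ℝ} (ht : t ∈ Icc 0 T) :
    Measurable[@Prod.instMeasurableSpace Ω ℝ (pointSigma N t) _]
      fun q : Ω × ℝ => l (projIcc 0 T hT (min q.2 t) : Icc (0 : ℝ) T) q.1 := by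
  let _ : MeasurableSpace Ω := pointSigma N t
  refine @Measurable.comp _ _ _ _ (predictableSigma N T) _
    (fun p : Icc (0 : ℝ) T × Ω => l (p.1 : ℝ) p.2)
    (fun q : Ω × ℝ => (projIcc 0 T hT (min q.2 t), q.1)) hl ?_
  refine measurable_generateFrom ?_
  rintro _ ⟨a, b, A, ha, hab, hbT, hA, rfl⟩
  have hproj : Measurable fun q : Ω × ℝ => ((projIcc 0 T hT (min q.2 t) : Icc (0 : ℝ) T) : ℝ) := by
    simp only [coe_projIcc]
    fun_prop
  rcases lt_or_ge a t with hat | hta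
  · exact (measurableSet_lt measurable_const hproj).inter
      ((measurableSet_le hproj measurable_const).inter
        (measurable_fst (pointSigma_mono N hat.le A hA)))
  · convert! (MeasurableSet.empty : MeasurableSet (∅ : Set (Ω × ℝ)))
    rw [Set.eq_empty_iff_forall_notMem]
    rintro q ⟨h1, -⟩
    have : ((projIcc 0 T hT (min q.2 t) : Icc (0 : ℝ) T) : ℝ) ≤ t := by
      rw [coe_projIcc]
      exact max_le ht.1 ((min_le_right _ _).trans (min_le_right _ _))
    exact absurd (h1.trans_le this) (not_lt.2 hta)

/-- The region whose points are counted by `thinnedCount N T l t ω`. -/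
def thinnedRegion (T : ℝ) (l : ℝ → Ω → ℝ) (t : ℝ) (ω : Ω) : Set (ℝ × ℝ) :=
  {p : ℝ × ℝ | p ∈ Icc 0 T ×ˢ Ici 0 ∧ p.1 < t ∧ p.2 ≤ l p.1 ω}

lemma measurableSet_thinnedRegion_prod {T : ℝ} (hT : 0 ≤ T) {l : ℝ → Ω → ℝ}
    (hl : Measurable[predictableSigma N T] fun p : Icc (0 : ℝ) T × Ω => l (p.1 : ℝ) p.2)
    {t : ℝ} (ht : t ∈ Icc 0 T) :
    MeasurableSet[@Prod.instMeasurableSpace Ω (ℝ × ℝ) (pointSigma N t) _]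
      {q : Ω × (ℝ × ℝ) | q.2 ∈ thinnedRegion T l t q.1} := by
  let _ : MeasurableSpace Ω := pointSigma N t
  have h1 : Measurable fun q : Ω × (ℝ × ℝ) =>
      l (projIcc 0 T hT (min q.2.1 t) : Icc (0 : ℝ) T) q.1 :=
    (measurable_of_predictable hT hl ht).comp
      (measurable_fst.prodMk (measurable_fst.comp measurable_snd))
  have h2 : {q : Ω × (ℝ × ℝ) | q.2 ∈ thinnedRegion T l t q.1}
      = {q | q.2 ∈ (Icc 0 T ×ˢ Ici 0 : Set (ℝ × ℝ))} ∩ ({q | q.2.1 < t} ∩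
        {q | q.2.2 ≤ l (projIcc 0 T hT (min q.2.1 t) : Icc (0 : ℝ) T) q.1}) := by
    ext q
    simp only [thinnedRegion, mem_inter_iff, mem_ofPred_eq]
    refine and_congr_right fun h => and_congr_right fun h' => ?_
    rw [min_eq_left h'.le, projIcc_of_mem hT h.1]
  rw [h2]
  exact (measurable_snd (measurableSet_Icc.prod measurableSet_Ici)).inter
    ((measurableSet_lt (measurable_fst.comp measurable_snd) measurable_const).inter
      (measurableSet_le (measurable_snd.comp measurable_snd) h1))

lemma measurableSet_thinnedRegion {T : ℝ} (hT : 0 ≤ T) {l : ℝ → Ω → ℝ}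
    (hl : Measurable[predictableSigma N T] fun p : Icc (0 : ℝ) T × Ω => l (p.1 : ℝ) p.2)
    {t : ℝ} (ht : t ∈ Icc 0 T) (ω : Ω) : MeasurableSet (thinnedRegion T l t ω) := by
  let _ : MeasurableSpace Ω := pointSigma N t
  exact measurable_prodMk_left (measurableSet_thinnedRegion_prod hT hl ht)

/-- The number of points under a predictable curve before time `t` is `𝓕_t`-measurable. -/
theorem measurable_thinnedCount
    (hN : ∀ (ω : Ω) (B : Set (ℝ × ℝ)), MeasurableSet B → Bornology.IsBounded B →
      ∃ n : ℕ, N ω B = (n : ℝ≥0∞)) {T : ℝ} (hT : 0 ≤ T) {l : ℝ → Ω → ℝ}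
    (hl : Measurable[predictableSigma N T] fun p : Icc (0 : ℝ) T × Ω => l (p.1 : ℝ) p.2)
    {t : ℝ} (ht : t ∈ Icc 0 T) :
    Measurable[pointSigma N t] (thinnedCount N T l t) := by
  let _ : MeasurableSpace Ω := pointSigma N t
  let box : ℕ → Set (ℝ × ℝ) := fun n => Icc 0 t ×ˢ Icc 0 (n : ℝ)
  have hbox : ∀ n, MeasurableSet (box n) := fun n => measurableSet_Icc.prod measurableSet_Icc
  have hbox_mono : Monotone box := fun m n h =>
    prod_mono Subset.rfl (Icc_subset_Icc_right (by exact_mod_cast h))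
  let κ : ℕ → Kernel Ω (ℝ × ℝ) := fun n =>
    { toFun := fun ω => (N ω).restrict (box n)
      measurable' := by
        refine Measure.measurable_of_measurable_coe _ fun B hB => ?_
        simp_rw [Measure.restrict_apply hB]
        exact measurable_pointSigma N (hB.inter (hbox n))
          (inter_subset_right.trans (prod_mono Subset.rfl Icc_subset_Ici_self)) }
  have hfin : ∀ n ω, IsFiniteMeasure (κ n ω) := by
    intro n ω
    refine ⟨?_⟩
    obtain ⟨m, hm⟩ := hN ω (box n) (hbox n)
      ((Metric.isBounded_Icc _ _).prod (Metric.isBounded_Icc _ _))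
    change (N ω).restrict (box n) univ < ∞
    rw [Measure.restrict_apply_univ, hm]
    exact ENNReal.natCast_lt_top m
  have hmeas := fun n => Kernel.measurable_kernel_prodMk_left_of_finite (κ := κ n)
    (measurableSet_thinnedRegion_prod hT hl ht) (hfin n)
  have heq : thinnedCount N T l t = fun ω => ⨆ n, κ n ω (Prod.mk ω ⁻¹'
      {q : Ω × (ℝ × ℝ) | q.2 ∈ thinnedRegion T l t q.1}) := by
    funext ω
    have hU : thinnedRegion T l t ω = ⋃ n, thinnedRegion T l t ω ∩ box n := by
      rw [← inter_iUnion, left_eq_inter]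
      intro p hp
      obtain ⟨n, hn⟩ := exists_nat_ge p.2
      exact mem_iUnion.2 ⟨n, ⟨⟨hp.1.1.1, hp.2.1.le⟩, hp.1.2, hn⟩⟩
    change N ω (thinnedRegion T l t ω) = ⨆ n, (N ω).restrict (box n) (thinnedRegion T l t ω)
    conv_lhs => rw [hU]
    rw [Monotone.measure_iUnion fun m n h => inter_subset_inter_right _ (hbox_mono h)]
    exact iSup_congr fun n =>
      (Measure.restrict_apply (measurableSet_thinnedRegion hT hl ht ω)).symm
  rw [heq]
  exact Measurable.iSup hmeas

end PointProcess

/-! ### Paths of the thinned counting process -/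

/-- The closed region under the graph of `a` over the open interval `(t, t')`. -/
def underGraph (a : ℝ → ℝ) (t t' : ℝ) : Set (ℝ × ℝ) :=
  {p | p.1 ∈ Ioo t t' ∧ p.2 ∈ Icc 0 (a p.1)}

section Paths

variable {Ω : Type*} {T : ℝ} {l : ℝ → Ω → ℝ} {ω : Ω} {M : Measure (ℝ × ℝ)} {x : ℝ → ℕ}

lemma thinnedRegion_mono {t t' : ℝ} (h : t ≤ t') :
    thinnedRegion T l t ω ⊆ thinnedRegion T l t' ω := fun _ hp =>
  ⟨hp.1, hp.2.1.trans_le h, hp.2.2⟩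

lemma count_mono (hx : ∀ t ∈ Icc 0 T, M (thinnedRegion T l t ω) = x t) {t t' : ℝ} (h0 : 0 ≤ t)
    (h : t ≤ t') (hT : t' ≤ T) : x t ≤ x t' := by
  have h1 := measure_mono (μ := M) (thinnedRegion_mono (T := T) (l := l) (ω := ω) h)
  rw [hx t ⟨h0, h.trans hT⟩, hx t' ⟨h0.trans h, hT⟩] at h1
  exact_mod_cast h1

lemma measure_strip_add (hm : ∀ t ∈ Icc 0 T, MeasurableSet (thinnedRegion T l t ω))
    (hx : ∀ t ∈ Icc 0 T, M (thinnedRegion T l t ω) = x t) {t t' : ℝ} (h0 : 0 ≤ t)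
    (h : t ≤ t') (hT : t' ≤ T) :
    M (thinnedRegion T l t' ω \ thinnedRegion T l t ω) + x t = x t' := by
  rw [← hx t ⟨h0, h.trans hT⟩, ← hx t' ⟨h0.trans h, hT⟩]
  have h' := measure_sdiff_add_inter (μ := M) (thinnedRegion T l t' ω) (hm t ⟨h0, h.trans hT⟩)
  rwa [inter_eq_right.2 (thinnedRegion_mono h)] at h'

/-- If the count passes the level `k` between the times `t` and `t'`, it does so by a jump at some
time `τ`: until then the count is at most `k`, and the points under the curve at times in `[t, τ]`
bring it above `k`. -/
lemma exists_crossing (hm : ∀ t ∈ Icc 0 T, MeasurableSet (thinnedRegion T l t ω))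
    (hx : ∀ t ∈ Icc 0 T, M (thinnedRegion T l t ω) = x t) {t t' : ℝ} (h0 : 0 ≤ t)
    (htt' : t ≤ t') (hT : t' ≤ T) {k : ℕ} (hk : x t ≤ k) (hk' : k < x t') :
    ∃ τ ∈ Ico t t', x τ ≤ k ∧
      (k + 1 : ℝ≥0∞) ≤ x t + M {p | p.1 ∈ Icc t τ ∧ p.2 ∈ Icc 0 (l p.1 ω)} := by
  set A : Set ℝ := {s | s ∈ Icc t t' ∧ x s ≤ k} with hA
  have hAne : A.Nonempty := ⟨t, ⟨le_rfl, htt'⟩, hk⟩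
  have hAbdd : BddAbove A := ⟨t', fun s hs => hs.1.2⟩
  set τ := sSup A with hτ
  have htτ : t ≤ τ := le_csSup hAbdd ⟨⟨le_rfl, htt'⟩, hk⟩
  have hτt' : τ ≤ t' := csSup_le hAne fun s hs => hs.1.2
  have hτT : τ ≤ T := hτt'.trans hT
  -- The count is left-continuous, so the level is not yet passed at the supremum.
  have hxτ : x τ ≤ k := by
    obtain ⟨u, hu, hut, huA⟩ := exists_seq_tendsto_sSup hAne hAbdd
    have hsub : thinnedRegion T l τ ω ⊆ ⋃ n, thinnedRegion T l (u n) ω := by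
      intro p hp
      obtain ⟨n, hn⟩ := (hut.eventually_const_lt hp.2.1).exists
      exact mem_iUnion.2 ⟨n, hp.1, hn, hp.2.2⟩
    have h1 := measure_mono (μ := M) hsub
    rw [Monotone.measure_iUnion fun m n h => thinnedRegion_mono (hu h),
      hx τ ⟨h0.trans htτ, hτT⟩] at h1
    have h2 : (x τ : ℝ≥0∞) ≤ k := h1.trans (iSup_le fun n => by
      rw [hx (u n) ⟨h0.trans (huA n).1.1, (huA n).1.2.trans hT⟩]
      exact_mod_cast (huA n).2)
    exact_mod_cast h2
  have hτlt : τ < t' := lt_of_le_of_ne hτt' fun h => by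
    rw [h] at hxτ; omega
  refine ⟨τ, ⟨htτ, hτlt⟩, hxτ, ?_⟩
  -- Let times decrease to `τ`; the level is passed at all of them.
  set v : ℕ → ℝ := fun n => τ + (t' - τ) / (n + 1) with hv
  have hvgt : ∀ n, τ < v n := fun n => by
    have : 0 < (t' - τ) / ((n : ℝ) + 1) := div_pos (by linarith) (by positivity)
    simp only [hv]; linarith
  have hvle : ∀ n, v n ≤ t' := fun n => by
    have : (t' - τ) / ((n : ℝ) + 1) ≤ t' - τ :=
      div_le_self (by linarith) (by linarith [n.cast_nonneg (α := ℝ)])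
    simp only [hv]; linarith
  have hvanti : Antitone v := fun m n h => by
    have : 0 ≤ t' - τ := by linarith
    simp only [hv]
    gcongr
  have hvt : Tendsto v atTop (𝓝 τ) := by
    have h := ((tendsto_one_div_add_atTop_nhds_zero_nat (𝕜 := ℝ)).const_mul (t' - τ)).const_add τ
    rw [mul_zero, add_zero] at h
    exact h.congr fun n => by simp only [hv, mul_one_div]
  have hvx : ∀ n, k + 1 ≤ x (v n) := by
    intro n
    by_contra hlt
    exact absurd (le_csSup hAbdd (show v n ∈ A from
      ⟨⟨htτ.trans (hvgt n).le, hvle n⟩, by omega⟩)) (not_le.2 (hvgt n))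
  set D : ℕ → Set (ℝ × ℝ) := fun n => thinnedRegion T l (v n) ω \ thinnedRegion T l t ω with hD
  have hDmeas : ∀ n, M (D n) + x t = x (v n) := fun n =>
    measure_strip_add hm hx h0 (htτ.trans (hvgt n).le) ((hvle n).trans hT)
  have hDsub : ⋂ n, D n ⊆ {p | p.1 ∈ Icc t τ ∧ p.2 ∈ Icc 0 (l p.1 ω)} := by
    intro p hp
    have hp' := mem_iInter.1 hp
    refine ⟨⟨?_, ge_of_tendsto' hvt fun n => (hp' n).1.2.1.le⟩, (hp' 0).1.1.2, (hp' 0).1.2.2⟩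
    by_contra hlt
    exact (hp' 0).2 ⟨(hp' 0).1.1, not_le.1 hlt, (hp' 0).1.2.2⟩
  have hinf : M (⋂ n, D n) = ⨅ n, M (D n) := by
    refine Antitone.measure_iInter (fun m n h => sdiff_subset_sdiff_left
      (thinnedRegion_mono (hvanti h))) (fun n => ?_) ⟨0, ?_⟩
    · exact ((hm _ ⟨h0.trans (htτ.trans (hvgt n).le), (hvle n).trans hT⟩).diff
        (hm t ⟨h0, htt'.trans hT⟩)).nullMeasurableSet
    · exact ne_top_of_le_ne_top (ENNReal.natCast_ne_top (x (v 0))) (hDmeas 0 ▸ le_self_add)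
  have hle : (k + 1 : ℝ≥0∞) - x t ≤ M (⋂ n, D n) := by
    rw [hinf]
    refine le_iInf fun n => tsub_le_iff_right.2 ?_
    rw [hDmeas n]
    exact_mod_cast hvx n
  exact tsub_le_iff_left.1 (hle.trans (measure_mono hDsub))

/-- With no point at the time `t`, a count equal to `k` at time `t` still has this value at
time `t'` exactly if there is no point under the graph of the intensity of the state `k`. -/
lemma count_eq_iff (hm : ∀ t ∈ Icc 0 T, MeasurableSet (thinnedRegion T l t ω))
    (hx : ∀ t ∈ Icc 0 T, M (thinnedRegion T l t ω) = x t) {a : ℕ → ℝ → ℝ}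
    (hl : ∀ s ∈ Ioc 0 T, l s ω = a (x s) s) {t t' : ℝ} (h0 : 0 < t) (htt' : t ≤ t')
    (hT : t' ≤ T) (hline : M ({t} ×ˢ univ) = 0) :
    x t' = x t ↔ M (underGraph (a (x t)) t t') = 0 := by
  constructor
  · intro h
    have hD := measure_strip_add hm hx h0.le htt' hT
    rw [h] at hD
    have hD0 : M (thinnedRegion T l t' ω \ thinnedRegion T l t ω) = 0 :=
      le_zero_iff.1 ((ENNReal.add_le_add_iff_right (ENNReal.natCast_ne_top (x t))).1
        (by rw [hD, zero_add]))
    refine measure_mono_null ?_ hD0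
    rintro p ⟨⟨h1, h2⟩, h3, h4⟩
    have hxp : x p.1 = x t := le_antisymm
      (h ▸ count_mono hx (h0.le.trans h1.le) h2.le hT) (count_mono hx h0.le h1.le (h2.le.trans hT))
    refine ⟨⟨⟨⟨h0.le.trans h1.le, h2.le.trans hT⟩, h3⟩, h2, ?_⟩, fun h5 =>
      absurd h5.2.1 (not_lt.2 h1.le)⟩
    rwa [hl p.1 ⟨h0.trans h1, h2.le.trans hT⟩, hxp]
  · intro h
    refine le_antisymm (not_lt.1 fun hlt => ?_) (count_mono hx h0.le htt' hT)
    obtain ⟨τ, hτ, hxτ, hZ⟩ := exists_crossing hm hx h0.le htt' hT le_rfl hlt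
    have hsub : {p : ℝ × ℝ | p.1 ∈ Icc t τ ∧ p.2 ∈ Icc 0 (l p.1 ω)}
        ⊆ {t} ×ˢ univ ∪ underGraph (a (x t)) t t' := by
      rintro p ⟨⟨h1, h2⟩, h3, h4⟩
      rcases h1.eq_or_lt with h5 | h5
      · exact Or.inl ⟨h5.symm, mem_univ _⟩
      · have hxp : x p.1 = x t := le_antisymm
          ((count_mono hx (h0.le.trans h1) h2 (hτ.2.le.trans hT)).trans hxτ)
          (count_mono hx h0.le h1 (h2.trans (hτ.2.le.trans hT)))
        refine Or.inr ⟨⟨h5, h2.trans_lt hτ.2⟩, h3, ?_⟩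
        rwa [hl p.1 ⟨h0.trans h5, h2.trans (hτ.2.le.trans hT)⟩, hxp] at h4
    rw [measure_mono_null hsub (measure_union_null hline h), add_zero] at hZ
    have : x t + 1 ≤ x t := by exact_mod_cast hZ
    omega

/-- A passage of the count from below `k` to above `k` takes two points at least. -/
lemma two_le_measure (hm : ∀ t ∈ Icc 0 T, MeasurableSet (thinnedRegion T l t ω))
    (hx : ∀ t ∈ Icc 0 T, M (thinnedRegion T l t ω) = x t) {a : ℕ → ℝ → ℝ}
    (hl : ∀ s ∈ Ioc 0 T, l s ω = a (x s) s) {t t' : ℝ} (h0 : 0 < t) (htt' : t ≤ t')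
    (hT : t' ≤ T) (hline : M ({t} ×ˢ univ) = 0) {k : ℕ} {C : ℝ}
    (hC : ∀ j ≤ k, ∀ s ∈ Icc t T, a j s ≤ C) (hk : x t < k) (hk' : k < x t') :
    2 ≤ M (Ioo t t' ×ˢ Icc 0 C) := by
  obtain ⟨τ, hτ, hxτ, hZ⟩ := exists_crossing hm hx h0.le htt' hT hk.le hk'
  have hsub : {p : ℝ × ℝ | p.1 ∈ Icc t τ ∧ p.2 ∈ Icc 0 (l p.1 ω)}
      ⊆ {t} ×ˢ univ ∪ Ioo t t' ×ˢ Icc 0 C := by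
    rintro p ⟨⟨h1, h2⟩, h3, h4⟩
    rcases h1.eq_or_lt with h5 | h5
    · exact Or.inl ⟨h5.symm, mem_univ _⟩
    · have hp2 : p.1 ≤ T := h2.trans (hτ.2.le.trans hT)
      have hxp : x p.1 ≤ k := (count_mono hx (h0.le.trans h1) h2 (hτ.2.le.trans hT)).trans hxτ
      rw [hl p.1 ⟨h0.trans h5, hp2⟩] at h4
      exact Or.inr ⟨⟨h5, h2.trans_lt hτ.2⟩, h3, h4.trans (hC _ hxp _ ⟨h1, hp2⟩)⟩
  have h1 : M {p : ℝ × ℝ | p.1 ∈ Icc t τ ∧ p.2 ∈ Icc 0 (l p.1 ω)} ≤ M (Ioo t t' ×ˢ Icc 0 C) := by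
    refine (measure_mono hsub).trans ((measure_union_le _ _).trans ?_)
    rw [hline, zero_add]
  have h2 : (x t : ℝ≥0∞) + 2 ≤ x t + M (Ioo t t' ×ˢ Icc 0 C) := by
    refine le_trans ?_ (hZ.trans (add_le_add le_rfl h1))
    exact_mod_cast (by omega : x t + 2 ≤ k + 1)
  exact (ENNReal.add_le_add_iff_left (ENNReal.natCast_ne_top _)).1 h2

end Paths

/-! ### The jump rates -/

lemma measurableSet_underGraph {a : ℝ → ℝ} (ha : Measurable a) (t t' : ℝ) :
    MeasurableSet (underGraph a t t') :=
  (measurable_fst measurableSet_Ioo).inter ((measurableSet_le measurable_const measurable_snd).inter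
    (measurableSet_le measurable_snd (ha.comp measurable_fst)))

lemma volume_underGraph {a : ℝ → ℝ} (ha : Measurable a) (t t' : ℝ) :
    volume (underGraph a t t') = ∫⁻ s in Ioo t t', ENNReal.ofReal (a s) := by
  rw [Measure.volume_eq_prod, Measure.prod_apply (measurableSet_underGraph ha t t'),
    ← lintegral_indicator measurableSet_Ioo]
  refine lintegral_congr fun s => ?_
  by_cases hs : s ∈ Ioo t t'
  · have : Prod.mk s ⁻¹' underGraph a t t' = Icc 0 (a s) := by
      ext y; simp [underGraph, hs.1, hs.2]
    rw [indicator_of_mem hs, this, Real.volume_Icc, sub_zero]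
  · have : Prod.mk s ⁻¹' underGraph a t t' = ∅ := by
      ext y
      simp only [underGraph, mem_preimage, mem_ofPred_eq, mem_empty_iff_false, iff_false]
      exact fun h => hs h.1
    rw [indicator_of_notMem hs, this, measure_empty]

/-- The jump rate `P_{T-s} f(k+1) / P_{T-s} f(k)` of the Poisson–Föllmer process in the state `k`,
set to `0` outside `(0, T]`, where the series need not converge. -/
def jumpRate (T : ℝ) (f : ℕ → ℝ) (k : ℕ) (s : ℝ) : ℝ :=
  (Ioc 0 T).indicator (fun s => evolved T f s (k + 1) / evolved T f s k) s

/-- An antiderivative of the jump rate in the state `k`. -/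
def cumulativeRate (T : ℝ) (f : ℕ → ℝ) (k : ℕ) (s : ℝ) : ℝ := s - Real.log (evolved T f s k)

section Rates

variable {T : ℝ} {f : ℕ → ℝ}

lemma jumpRate_of_mem {k : ℕ} {s : ℝ} (hs0 : s ∈ Ioc 0 T) :
    jumpRate T f k s = evolved T f s (k + 1) / evolved T f s k := indicator_of_mem hs0 _

lemma jumpRate_pos (hT : 0 < T) (hf : ∀ k, 0 < f k)
    (hs : Summable fun k => f k * poissonWeight T k) (k : ℕ) {s : ℝ} (hs0 : s ∈ Ioc 0 T) :
    0 < jumpRate T f k s := by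
  rw [jumpRate_of_mem hs0]
  exact div_pos (evolved_pos hT hf hs _ hs0) (evolved_pos hT hf hs _ hs0)

lemma continuousOn_jumpRate (hT : 0 < T) (hf : ∀ k, 0 < f k)
    (hs : Summable fun k => f k * poissonWeight T k) (k : ℕ) :
    ContinuousOn (jumpRate T f k) (Ioc 0 T) :=
  ((continuousOn_evolved hT hf hs (k + 1)).div (continuousOn_evolved hT hf hs k)
    fun _ hs0 => (evolved_pos hT hf hs k hs0).ne').congr fun _ hs0 => jumpRate_of_mem hs0

lemma measurable_jumpRate (hT : 0 < T) (hf : ∀ k, 0 < f k)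
    (hs : Summable fun k => f k * poissonWeight T k) (k : ℕ) : Measurable (jumpRate T f k) := by
  classical
  have h : jumpRate T f k = (Ioc 0 T).piecewise
      (fun s => evolved T f s (k + 1) / evolved T f s k) 0 := by
    rw [piecewise_eq_indicator]
    rfl
  rw [h]
  exact ContinuousOn.measurable_piecewise ((continuousOn_evolved hT hf hs (k + 1)).div
    (continuousOn_evolved hT hf hs k) fun _ hs0 => (evolved_pos hT hf hs k hs0).ne')
    continuousOn_const measurableSet_Ioc

lemma hasDerivAt_cumulativeRate (hT : 0 < T) (hf : ∀ k, 0 < f k)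
    (hs : Summable fun k => f k * poissonWeight T k) (k : ℕ) {s : ℝ} (hs0 : s ∈ Ioc 0 T) :
    HasDerivAt (cumulativeRate T f k) (jumpRate T f k s) s := by
  have h0 := (evolved_pos hT hf hs k hs0).ne'
  have h := (hasDerivAt_id s).sub
    ((hasDerivAt_evolved hT hf hs k (abs_sub_lt_of_mem_Ioc hs0)).log h0)
  convert! h using 1
  rw [jumpRate_of_mem hs0]
  field_simp
  ring

lemma integral_jumpRate (hT : 0 < T) (hf : ∀ k, 0 < f k)
    (hs : Summable fun k => f k * poissonWeight T k) (k : ℕ) {t t' : ℝ} (ht : 0 < t)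
    (htt' : t ≤ t') (ht' : t' ≤ T) :
    ∫ s in t..t', jumpRate T f k s = cumulativeRate T f k t' - cumulativeRate T f k t := by
  have hsub : Icc t t' ⊆ Ioc 0 T := fun s h => ⟨ht.trans_le h.1, h.2.trans ht'⟩
  refine intervalIntegral.integral_eq_sub_of_hasDerivAt (fun s h => ?_)
    (((continuousOn_jumpRate hT hf hs k).mono hsub).intervalIntegrable_of_Icc htt')
  rw [uIcc_of_le htt'] at h
  exact hasDerivAt_cumulativeRate hT hf hs k (hsub h)

lemma cumulativeRate_mono (hT : 0 < T) (hf : ∀ k, 0 < f k)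
    (hs : Summable fun k => f k * poissonWeight T k) (k : ℕ) {t t' : ℝ} (ht : 0 < t)
    (htt' : t ≤ t') (ht' : t' ≤ T) : cumulativeRate T f k t ≤ cumulativeRate T f k t' := by
  rw [← sub_nonneg, ← integral_jumpRate hT hf hs k ht htt' ht']
  exact intervalIntegral.integral_nonneg htt' fun s h =>
    (jumpRate_pos hT hf hs k ⟨ht.trans_le h.1, h.2.trans ht'⟩).le

lemma volume_underGraph_jumpRate (hT : 0 < T) (hf : ∀ k, 0 < f k)
    (hs : Summable fun k => f k * poissonWeight T k) (k : ℕ) {t t' : ℝ} (ht : 0 < t)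
    (htt' : t ≤ t') (ht' : t' ≤ T) :
    volume (underGraph (jumpRate T f k) t t')
      = ENNReal.ofReal (cumulativeRate T f k t' - cumulativeRate T f k t) := by
  have hsub : Icc t t' ⊆ Ioc 0 T := fun s h => ⟨ht.trans_le h.1, h.2.trans ht'⟩
  rw [volume_underGraph (measurable_jumpRate hT hf hs k),
    ← integral_jumpRate hT hf hs k ht htt' ht',
    intervalIntegral.integral_of_le htt', ofReal_integral_eq_lintegral_ofReal,
    setLIntegral_congr Ioo_ae_eq_Ioc]
  · exact ((continuousOn_jumpRate hT hf hs k).mono hsub).integrableOn_Icc.mono_set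
      Ioc_subset_Icc_self
  · exact (ae_restrict_iff' measurableSet_Ioc).2 (ae_of_all _ fun s h =>
      (jumpRate_pos hT hf hs k (hsub (Ioc_subset_Icc_self h))).le)

lemma exists_jumpRate_le (hT : 0 < T) (hf : ∀ k, 0 < f k)
    (hs : Summable fun k => f k * poissonWeight T k) (k : ℕ) {r : ℝ} (hr : 0 < r) :
    ∃ C, 0 ≤ C ∧ ∀ j ≤ k, ∀ s ∈ Icc r T, jumpRate T f j s ≤ C := by
  have hb : ∀ j, ∃ C, 0 ≤ C ∧ ∀ s ∈ Icc r T, jumpRate T f j s ≤ C := by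
    intro j
    obtain ⟨C, hC⟩ := (isCompact_Icc (a := r) (b := T)).exists_bound_of_continuousOn
      ((continuousOn_jumpRate hT hf hs j).mono fun s h => ⟨hr.trans_le h.1, h.2⟩)
    exact ⟨max C 0, le_max_right _ _, fun s h =>
      (le_abs_self _).trans ((hC s h).trans (le_max_left _ _))⟩
  choose C hC0 hC using hb
  refine ⟨∑ j ∈ Finset.range (k + 1), C j, Finset.sum_nonneg fun j _ => hC0 j,
    fun j hj s h => (hC j s h).trans ?_⟩
  exact Finset.single_le_sum (f := C) (fun j _ => hC0 j) (Finset.mem_range.2 (by omega))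

/-- The probability `∑_{j<k} P_{T-s} f(j) π_s(j)` of a state smaller than `k` under the law which
the Poisson–Föllmer process has at time `s`. -/
def lowerMass (T : ℝ) (f : ℕ → ℝ) (k : ℕ) (s : ℝ) : ℝ :=
  ∑ j ∈ Finset.range k, evolved T f s j * poissonWeight s j

lemma hasDerivAt_lowerMass (hT : 0 < T) (hf : ∀ k, 0 < f k)
    (hs : Summable fun k => f k * poissonWeight T k) (k : ℕ) {s : ℝ} (hs0 : s ∈ Ioc 0 T) :
    HasDerivAt (lowerMass T f k) (-(evolved T f s k * poissonWeightPred s k)) s := by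
  induction k with
  | zero => simpa [lowerMass, poissonWeightPred] using! hasDerivAt_const s (0 : ℝ)
  | succ k ih =>
    have h := ih.add ((hasDerivAt_evolved hT hf hs k (abs_sub_lt_of_mem_Ioc hs0)).mul
      (hasDerivAt_poissonWeight s k))
    have hQ : lowerMass T f (k + 1) =
        fun s => lowerMass T f k s + evolved T f s k * poissonWeight s k :=
      funext fun s => Finset.sum_range_succ _ _
    rw [hQ]
    convert! h using 1
    simp only [poissonWeightPred]
    ring

lemma lowerMass_le_one (hT : 0 < T) (hf : ∀ k, 0 < f k)
    (hf_one : HasSum (fun k => f k * poissonWeight T k) 1) (k : ℕ) {s : ℝ} (hs0 : s ∈ Ioc 0 T) :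
    lowerMass T f k s ≤ 1 :=
  sum_le_hasSum _ (fun j _ => mul_nonneg (evolved_pos hT hf hf_one.summable j hs0).le
    (poissonWeight_nonneg hs0.1.le j)) (hasSum_evolved_mul_poissonWeight hT hf hf_one hs0)

lemma lowerMass_one_le (hT : 0 < T) (hf : ∀ k, 0 < f k)
    (hs : Summable fun k => f k * poissonWeight T k) (k : ℕ) {s : ℝ} (hs0 : s ∈ Ioc 0 T) :
    lowerMass T f 1 s ≤ lowerMass T f (k + 1) s :=
  Finset.sum_le_sum_of_subset_of_nonneg (Finset.range_mono (by omega)) fun j _ _ =>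
    mul_nonneg (evolved_pos hT hf hs j hs0).le (poissonWeight_nonneg hs0.1.le j)

lemma tendsto_lowerMass_one (hT : 0 < T) (hf : ∀ k, 0 < f k)
    (hf_one : HasSum (fun k => f k * poissonWeight T k) 1) :
    Tendsto (lowerMass T f 1) (𝓝[>] 0) (𝓝 1) := by
  have h : Tendsto (fun r : ℝ => poissonWeight r 0) (𝓝 0) (𝓝 (poissonWeight 0 0)) :=
    (continuous_poissonWeight 0).tendsto 0
  rw [poissonWeight_zero, neg_zero, Real.exp_zero] at h
  have h' := (tendsto_evolved_zero hT hf hf_one).mul (h.mono_left nhdsWithin_le_nhds)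
  rw [mul_one] at h'
  exact h'.congr fun r => by simp [lowerMass]

/-- Uniqueness for the forward equation, state by state. If the increments of `G` over short
intervals are those of a distribution function whose mass at `k` jumps out at the given rate, and
if the masses below `k` are the expected ones, then the difference to `lowerMass` is damped by the
rate, so that its size is bounded by the one at any earlier time. -/
lemma abs_sub_lowerMass_le (hT : 0 < T) (hf : ∀ k, 0 < f k)
    (hs : Summable fun k => f k * poissonWeight T k) (k : ℕ) {r : ℝ} (hr : 0 < r)
    {G : ℝ → ℝ} {C : ℝ} (hp : ∀ t ∈ Icc r T, |G t - lowerMass T f k t| ≤ 1)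
    (hG : ∀ t t', r ≤ t → t ≤ t' → t' ≤ T →
      |G t' - G t + (G t - lowerMass T f k t) *
        (1 - Real.exp (-(cumulativeRate T f k t' - cumulativeRate T f k t)))|
        ≤ (C * (t' - t)) ^ 2) {t : ℝ} (ht : t ∈ Icc r T) :
    |G t - lowerMass T f (k + 1) t| ≤ |G r - lowerMass T f (k + 1) r| := by
  set V := cumulativeRate T f k with hV
  have hsub : Icc r T ⊆ Ioc 0 T := fun s h => ⟨hr.trans_le h.1, h.2⟩
  have hVc : ContinuousOn V (Icc r T) := fun s h =>
    (hasDerivAt_cumulativeRate hT hf hs k (hsub h)).continuousAt.continuousWithinAt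
  have hbound : ∀ t t', r ≤ t → t ≤ t' → t' ≤ T →
      |G t' - G t| ≤ |1 - Real.exp (-|V t' - V t|)| + (C * (t' - t)) ^ 2 := by
    intro t t' h1 h2 h3
    have h4 := hG t t' h1 h2 h3
    have h5 := hp t ⟨h1, h2.trans h3⟩
    rw [abs_of_nonneg (sub_nonneg.2 (cumulativeRate_mono hT hf hs k (hr.trans_le h1) h2 h3))]
    have h6 : |(G t - lowerMass T f k t) * (1 - Real.exp (-(V t' - V t)))|
        ≤ |1 - Real.exp (-(V t' - V t))| := by
      rw [abs_mul]
      exact mul_le_of_le_one_left (abs_nonneg _) h5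
    have h7 := abs_sub (G t' - G t + (G t - lowerMass T f k t) * (1 - Real.exp (-(V t' - V t))))
      ((G t - lowerMass T f k t) * (1 - Real.exp (-(V t' - V t))))
    rw [add_sub_cancel_right] at h7
    linarith
  have hGc : ContinuousOn G (Icc r T) := by
    intro t ht
    rw [ContinuousWithinAt, tendsto_iff_norm_sub_tendsto_zero]
    have hlim : Tendsto (fun s => |1 - Real.exp (-|V s - V t|)| + (C * (s - t)) ^ 2)
        (𝓝[Icc r T] t) (𝓝 0) := by
      have hc : ContinuousWithinAt
          (fun s => |1 - Real.exp (-|V s - V t|)| + (C * (s - t)) ^ 2) (Icc r T) t := by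
        have := hVc t ht
        fun_prop
      simpa [ContinuousWithinAt] using hc
    refine tendsto_of_tendsto_of_tendsto_of_le_of_le' tendsto_const_nhds hlim
      (Eventually.of_forall fun _ => norm_nonneg _) ?_
    filter_upwards [self_mem_nhdsWithin] with s hs'
    rw [Real.norm_eq_abs]
    rcases le_total t s with h | h
    · exact hbound t s ht.1 h hs'.2
    · have h1 := hbound s t hs'.1 h ht.2
      rw [abs_sub_comm (G t), abs_sub_comm (V t)] at h1
      nlinarith
  have hGd : ∀ t ∈ Ico r T,
      HasDerivWithinAt G (-((G t - lowerMass T f k t) * jumpRate T f k t)) (Ici t) t := by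
    intro t ht
    have htT : t ∈ Ioc 0 T := hsub (Ico_subset_Icc_self ht)
    set p := G t - lowerMass T f k t with hp_def
    set rem : ℝ → ℝ := fun s => G s - G t + p * (1 - Real.exp (-(V s - V t))) with hrem
    have hrem_d : HasDerivWithinAt rem 0 (Ici t) t := by
      have hO : rem =O[𝓝[Ici t] t] fun s => ‖s - t‖ ^ 2 := by
        refine Asymptotics.IsBigO.of_bound (C ^ 2) ?_
        filter_upwards [Icc_mem_nhdsGE ht.2] with s hs'
        have h := hG t s ht.1 hs'.1 hs'.2
        rw [Real.norm_eq_abs, norm_pow, norm_norm, Real.norm_eq_abs, sq_abs, ← mul_pow]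
        exact h
      have h := hO.hasFDerivWithinAt (𝕜 := ℝ) self_mem_Ici one_lt_two
      simpa using h.hasDerivWithinAt
    have hVd := (hasDerivAt_cumulativeRate hT hf hs k htT).hasDerivWithinAt (s := Ici t)
    have hexp := (((hVd.sub_const (V t)).neg.exp.const_sub 1).const_mul p).const_sub (G t)
    have h := hexp.add hrem_d
    convert! h using 1
    · funext s
      simp only [hrem, Pi.add_apply]
      simp only [Pi.neg_apply, ← hV]
      ring
    · simp [← hV]
  have hdV : ∀ s ∈ Icc r T,
      (G s - lowerMass T f (k + 1) s) * Real.exp (V s)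
        = (G r - lowerMass T f (k + 1) r) * Real.exp (V r) := by
    refine constant_of_has_deriv_right_zero
      (f := fun s => (G s - lowerMass T f (k + 1) s) * Real.exp (V s)) ?_ ?_
    · refine (hGc.sub fun s h => ?_).mul hVc.rexp
      exact (hasDerivAt_lowerMass hT hf hs (k + 1) (hsub h)).continuousAt.continuousWithinAt
    · intro s h
      have hs0 := hsub (Ico_subset_Icc_self h)
      have hd := ((hGd s h).sub
        (hasDerivAt_lowerMass hT hf hs (k + 1) hs0).hasDerivWithinAt).mul
        (hasDerivAt_cumulativeRate hT hf hs k hs0).hasDerivWithinAt.exp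
      convert! hd using 1
      have hu := (evolved_pos hT hf hs k hs0).ne'
      have hQ : lowerMass T f (k + 1) s
          = lowerMass T f k s + evolved T f s k * poissonWeight s k :=
        Finset.sum_range_succ _ _
      simp only [Pi.sub_apply, poissonWeightPred]
      rw [hQ, jumpRate_of_mem hs0]
      field_simp
      ring
  have heq := hdV t ht
  have hmono : V r ≤ V t := cumulativeRate_mono hT hf hs k hr ht.1 ht.2
  have h1 := congrArg abs heq
  rw [abs_mul, abs_mul, Real.abs_exp, Real.abs_exp] at h1
  have h2 : |G r - lowerMass T f (k + 1) r| * Real.exp (V r)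
      ≤ |G r - lowerMass T f (k + 1) r| * Real.exp (V t) :=
    mul_le_mul_of_nonneg_left (Real.exp_le_exp.2 hmono) (abs_nonneg _)
  exact le_of_mul_le_mul_right (h1.trans_le h2) (Real.exp_pos _)

end Rates

/-! ### The one-dimensional laws of the Poisson–Föllmer process -/

section Law

variable {Ω : Type*} [mΩ : MeasurableSpace Ω] {P : Measure Ω} {N : Ω → Measure (ℝ × ℝ)}

lemma IsPoissonPointProcess.measure_eq_zero {ν : Measure (ℝ × ℝ)}
    (hN : IsPoissonPointProcess N ν P) {B : Set (ℝ × ℝ)} (hB : MeasurableSet B) (hν : ν B ≠ ∞) :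
    P {ω | N ω B = 0} = ENNReal.ofReal (Real.exp (-(ν B).toReal)) := by
  have h := congrArg (fun μ => μ {0}) (hN.law_count B hB hν)
  rw [Measure.map_apply (hN.measurable_count B hB) (measurableSet_singleton 0),
    Measure.map_apply .of_discrete (measurableSet_singleton 0)] at h
  have hpre : (fun n : ℕ => (n : ℝ≥0∞)) ⁻¹' {0} = {0} := by ext n; simp
  rw [hpre, poissonMeasure_singleton] at h
  simpa [preimage, ENNReal.coe_toNNReal_eq_toReal] using! h

lemma IsPoissonPointProcess.measureReal_ne_zero [IsProbabilityMeasure P] {ν : Measure (ℝ × ℝ)}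
    (hN : IsPoissonPointProcess N ν P) {B : Set (ℝ × ℝ)} (hB : MeasurableSet B) (hν : ν B ≠ ∞) :
    P.real {ω | N ω B ≠ 0} = 1 - Real.exp (-(ν B).toReal) := by
  have h := probReal_compl_eq_one_sub (μ := P)
    ((hN.measurable_count B hB) (measurableSet_singleton 0))
  have h' := hN.measure_eq_zero hB hν
  rw [measureReal_def P ((fun ω => N ω B) ⁻¹' {0}),
    show (fun ω => N ω B) ⁻¹' {0} = {ω | N ω B = 0} from rfl, h',
    ENNReal.toReal_ofReal (Real.exp_pos _).le] at h
  exact h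

lemma IsPoissonPointProcess.ae_eq_zero [IsProbabilityMeasure P] {ν : Measure (ℝ × ℝ)}
    (hN : IsPoissonPointProcess N ν P) {B : Set (ℝ × ℝ)} (hB : MeasurableSet B) (hν : ν B = 0) :
    ∀ᵐ ω ∂P, N ω B = 0 := by
  have h := hN.measureReal_ne_zero hB (by simp [hν])
  rw [hν, ENNReal.toReal_zero, neg_zero, Real.exp_zero, sub_self, measureReal_eq_zero_iff] at h
  exact h

/-- Two points or more in a set of small intensity are unlikely to second order. -/
lemma IsPoissonPointProcess.measureReal_two_le [IsProbabilityMeasure P] {ν : Measure (ℝ × ℝ)}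
    (hN : IsPoissonPointProcess N ν P) {B : Set (ℝ × ℝ)} (hB : MeasurableSet B) (hν : ν B ≠ ∞) :
    P.real {ω | 2 ≤ N ω B} ≤ (ν B).toReal ^ 2 := by
  have h := congrArg (fun μ => μ {y | 2 ≤ y}) (hN.law_count B hB hν)
  have hms : MeasurableSet {y : ℝ≥0∞ | 2 ≤ y} := measurableSet_Ici
  rw [Measure.map_apply (hN.measurable_count B hB) hms,
    Measure.map_apply .of_discrete hms] at h
  set m : ℝ≥0 := (ν B).toNNReal with hm
  have hpre : (fun n : ℕ => (n : ℝ≥0∞)) ⁻¹' {y | 2 ≤ y} = ((({0, 1} : Finset ℕ) : Set ℕ))ᶜ := by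
    ext n
    simp only [mem_preimage, mem_ofPred_eq, mem_compl_iff, Finset.mem_coe, Finset.mem_insert,
      Finset.mem_singleton]
    constructor
    · intro h'
      have : 2 ≤ n := by exact_mod_cast h'
      omega
    · intro h'
      have : 2 ≤ n := by omega
      exact_mod_cast this
  have hreal : P.real {ω | 2 ≤ N ω B} = 1 - (Real.exp (-m) + Real.exp (-m) * m) := by
    have h1 : P.real {ω | 2 ≤ N ω B} = (poissonMeasure m).real ((({0, 1} : Finset ℕ) : Set ℕ)ᶜ) := by
      rw [measureReal_def, measureReal_def, ← hpre, ← h]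
      rfl
    rw [h1, probReal_compl_eq_one_sub (Finset.measurableSet _), ← sum_measureReal_singleton,
      Finset.sum_pair zero_ne_one, poissonMeasure_real_singleton, poissonMeasure_real_singleton]
    simp
  rw [hreal, show (ν B).toReal = (m : ℝ) from rfl]
  have h2 := Real.add_one_le_exp (-(m : ℝ))
  have h3 : (0 : ℝ) ≤ m := m.2
  nlinarith

variable {T : ℝ} {f : ℕ → ℝ} {X : ℝ → Ω → ℕ} {l : ℝ → Ω → ℝ}

/-- The number of points under the curve as a natural number: a version of the counting process
whose value at time `t` is `𝓕_t`-measurable. -/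
def countVersion (N : Ω → Measure (ℝ × ℝ)) (T : ℝ) (l : ℝ → Ω → ℝ) (t : ℝ) (ω : Ω) : ℕ :=
  ⌊(thinnedCount N T l t ω).toReal⌋₊

lemma IsPoissonFollmer.measurable_countVersion (hX : IsPoissonFollmer P N T f X l) (hT : 0 < T)
    {t : ℝ} (ht : t ∈ Icc 0 T) : Measurable[pointSigma N t] (countVersion N T l t) :=
  Nat.measurable_floor.comp (measurable_thinnedCount hX.poisson.count_nat hT.le
    hX.predictable ht).ennreal_toReal

lemma IsPoissonFollmer.measurable_countVersion' (hX : IsPoissonFollmer P N T f X l) (hT : 0 < T)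
    {t : ℝ} (ht : t ∈ Icc 0 T) : Measurable (countVersion N T l t) :=
  (hX.measurable_countVersion hT ht).mono (hX.poisson.pointSigma_le t) le_rfl

lemma IsPoissonFollmer.ae_countVersion_eq (hX : IsPoissonFollmer P N T f X l) :
    ∀ᵐ ω ∂P, ∀ t ∈ Icc 0 T, countVersion N T l t ω = X t ω := by
  filter_upwards [hX.count] with ω h t ht
  rw [countVersion, h t ht, ENNReal.toReal_natCast, Nat.floor_natCast]

lemma IsPoissonFollmer.ae_measure_thinnedRegion (hX : IsPoissonFollmer P N T f X l) :
    ∀ᵐ ω ∂P, ∀ t ∈ Icc 0 T, N ω (thinnedRegion T l t ω) = countVersion N T l t ω := by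
  filter_upwards [hX.count, hX.ae_countVersion_eq] with ω h h' t ht
  rw [h' t ht, ← h t ht]
  rfl

lemma IsPoissonFollmer.ae_intensity (hX : IsPoissonFollmer P N T f X l) :
    ∀ᵐ ω ∂P, ∀ s ∈ Ioc 0 T, l s ω = jumpRate T f (countVersion N T l s ω) s := by
  filter_upwards [hX.intensity, hX.ae_countVersion_eq] with ω h h' s hs
  rw [h s (Ioc_subset_Icc_self hs), h' s (Ioc_subset_Icc_self hs), jumpRate_of_mem hs]
  rfl

lemma IsPoissonFollmer.ae_line (hX : IsPoissonFollmer P N T f X l) [IsProbabilityMeasure P]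
    (t : ℝ) : ∀ᵐ ω ∂P, N ω ({t} ×ˢ univ) = 0 := by
  refine hX.poisson.ae_eq_zero ((measurableSet_singleton t).prod MeasurableSet.univ)
    (le_zero_iff.1 ((Measure.restrict_apply_le _ _).trans ?_))
  rw [Measure.volume_eq_prod, Measure.prod_prod, Real.volume_singleton, zero_mul]

/-- The distribution function `P(X_t < k)`. -/
def distribution (P : Measure Ω) (N : Ω → Measure (ℝ × ℝ)) (T : ℝ) (l : ℝ → Ω → ℝ) (k : ℕ)
    (t : ℝ) : ℝ :=
  P.real {ω | countVersion N T l t ω < k}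

/-- The process stays in the state `k` up to time `t'` exactly if there is no point in a region
which is independent of the past and whose area is the increase of the cumulative rate. -/
lemma IsPoissonFollmer.measureReal_jump [IsProbabilityMeasure P]
    (hX : IsPoissonFollmer P N T f X l) (hT : 0 < T) (hf : ∀ k, 0 < f k)
    (hs : Summable fun k => f k * poissonWeight T k) (k : ℕ) {t t' : ℝ} (ht : 0 < t)
    (htt' : t ≤ t') (ht' : t' ≤ T) :
    P.real {ω | countVersion N T l t ω = k ∧ k < countVersion N T l t' ω}
      = P.real {ω | countVersion N T l t ω = k} *
        (1 - Real.exp (-(cumulativeRate T f k t' - cumulativeRate T f k t))) := by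
  have htT : t ∈ Icc 0 T := ⟨ht.le, htt'.trans ht'⟩
  set U := underGraph (jumpRate T f k) t t' with hU
  have hUm : MeasurableSet U := measurableSet_underGraph (measurable_jumpRate hT hf hs k) t t'
  have hUsub : U ⊆ Icc 0 T ×ˢ Ici 0 := fun p hp =>
    ⟨⟨ht.le.trans hp.1.1.le, hp.1.2.le.trans ht'⟩, hp.2.1⟩
  have hνU : (volume.restrict (Icc 0 T ×ˢ Ici 0)) U
      = ENNReal.ofReal (cumulativeRate T f k t' - cumulativeRate T f k t) := by
    rw [Measure.restrict_eq_self _ hUsub, volume_underGraph_jumpRate hT hf hs k ht htt' ht']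
  have hdisj : Disjoint U (Icc 0 t ×ˢ Ici 0) := by
    rw [Set.disjoint_left]
    exact fun p hp hp' => absurd hp'.1.2 (not_le.2 hp.1.1)
  have hae : {ω | countVersion N T l t ω = k ∧ k < countVersion N T l t' ω} =ᵐ[P]
      ({ω | countVersion N T l t ω = k} ∩ {ω | N ω U ≠ 0} : Set Ω) := by
    filter_upwards [hX.ae_measure_thinnedRegion, hX.ae_intensity, hX.ae_line t] with ω h1 h2 h3
    have hiff := count_eq_iff (x := fun t => countVersion N T l t ω)
      (fun t ht => measurableSet_thinnedRegion hT.le hX.predictable ht ω) h1 h2 ht htt' ht' h3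
    have hmono := count_mono (x := fun t => countVersion N T l t ω) h1 ht.le htt' ht'
    refine propext (and_congr_right fun (hk : countVersion N T l t ω = k) => ?_)
    simp only [hk] at hiff hmono
    change k < countVersion N T l t' ω ↔ ¬ N ω U = 0
    rw [← hiff]
    omega
  have hind := Indep_iff _ _ P |>.1 (hX.poisson.indep_pointSigma hUm hdisj)
    {ω | countVersion N T l t ω = k} {ω | N ω U ≠ 0}
    (hX.measurable_countVersion hT htT (measurableSet_singleton k))
    ⟨{0}ᶜ, (measurableSet_singleton 0).compl, rfl⟩
  have hne := hX.poisson.measureReal_ne_zero hUm (by rw [hνU]; exact ENNReal.ofReal_ne_top)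
  rw [hνU, ENNReal.toReal_ofReal (sub_nonneg.2 (cumulativeRate_mono hT hf hs k ht htt' ht'))] at hne
  rw [measureReal_congr hae, ← hne, measureReal_def, hind, ENNReal.toReal_mul]
  rfl

lemma IsPoissonFollmer.measureReal_double_jump_le [IsProbabilityMeasure P]
    (hX : IsPoissonFollmer P N T f X l) (hT : 0 < T) {k : ℕ} {t t' C : ℝ} (ht : 0 < t)
    (htt' : t ≤ t') (ht' : t' ≤ T) (hC0 : 0 ≤ C)
    (hC : ∀ j ≤ k, ∀ s ∈ Icc t T, jumpRate T f j s ≤ C) :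
    P.real {ω | countVersion N T l t ω < k ∧ k < countVersion N T l t' ω}
      ≤ (C * (t' - t)) ^ 2 := by
  set B : Set (ℝ × ℝ) := Ioo t t' ×ˢ Icc 0 C with hB
  have hBm : MeasurableSet B := measurableSet_Ioo.prod measurableSet_Icc
  have hBsub : B ⊆ Icc 0 T ×ˢ Ici 0 := fun p hp =>
    ⟨⟨ht.le.trans hp.1.1.le, hp.1.2.le.trans ht'⟩, hp.2.1⟩
  have hνB : (volume.restrict (Icc 0 T ×ˢ Ici 0)) B = ENNReal.ofReal (C * (t' - t)) := by
    rw [Measure.restrict_eq_self _ hBsub, Measure.volume_eq_prod, hB, Measure.prod_prod,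
      Real.volume_Ioo, Real.volume_Icc, sub_zero, mul_comm, ← ENNReal.ofReal_mul hC0]
  have h := hX.poisson.measureReal_two_le hBm (by rw [hνB]; exact ENNReal.ofReal_ne_top)
  rw [hνB, ENNReal.toReal_ofReal (mul_nonneg hC0 (by linarith))] at h
  refine le_trans (ENNReal.toReal_mono (measure_ne_top _ _) (measure_mono_ae ?_)) h
  filter_upwards [hX.ae_measure_thinnedRegion, hX.ae_intensity, hX.ae_line t] with ω h1 h2 h3
  exact fun hk => two_le_measure (x := fun t => countVersion N T l t ω)
    (fun t ht => measurableSet_thinnedRegion hT.le hX.predictable ht ω) h1 h2 ht htt' ht' h3 hC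
    hk.1 hk.2

lemma IsPoissonFollmer.distribution_succ [IsProbabilityMeasure P]
    (hX : IsPoissonFollmer P N T f X l) (hT : 0 < T) (k : ℕ) {t : ℝ} (ht : t ∈ Icc 0 T) :
    distribution P N T l (k + 1) t
      = distribution P N T l k t + P.real {ω | countVersion N T l t ω = k} := by
  unfold distribution
  have hdisj : Disjoint {ω | countVersion N T l t ω < k} {ω | countVersion N T l t ω = k} :=
    Set.disjoint_left.2 fun ω h h' => absurd h' (ne_of_lt h)
  have hm : MeasurableSet {ω | countVersion N T l t ω = k} :=
    hX.measurable_countVersion' hT ht (measurableSet_singleton k)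
  rw [← measureReal_union hdisj hm]
  congr 1
  ext ω
  simp only [mem_union, mem_ofPred_eq]
  omega

/-- The increments of the distribution functions: up to a second order error, mass leaves
`{0, …, k}` only by a jump out of `k`. -/
lemma IsPoissonFollmer.exists_distribution_increment [IsProbabilityMeasure P]
    (hX : IsPoissonFollmer P N T f X l) (hT : 0 < T) (hf : ∀ k, 0 < f k)
    (hs : Summable fun k => f k * poissonWeight T k) (k : ℕ) {r : ℝ} (hr : 0 < r) :
    ∃ C, ∀ t t', r ≤ t → t ≤ t' → t' ≤ T →
      |distribution P N T l (k + 1) t' - distribution P N T l (k + 1) t +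
        (distribution P N T l (k + 1) t - distribution P N T l k t) *
          (1 - Real.exp (-(cumulativeRate T f k t' - cumulativeRate T f k t)))|
        ≤ (C * (t' - t)) ^ 2 := by
  obtain ⟨C, hC0, hC⟩ := exists_jumpRate_le hT hf hs k hr
  refine ⟨C, fun t t' hrt htt' ht' => ?_⟩
  have ht : 0 < t := hr.trans_le hrt
  have htT : t ∈ Icc 0 T := ⟨ht.le, htt'.trans ht'⟩
  have htT' : t' ∈ Icc 0 T := ⟨ht.le.trans htt', ht'⟩
  have hm := hX.measurable_countVersion' hT htT
  have hm' := hX.measurable_countVersion' hT htT'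
  set E₁ : Set Ω := {ω | countVersion N T l t' ω < k + 1} with hE₁
  set E₂ : Set Ω := {ω | countVersion N T l t ω = k ∧ k < countVersion N T l t' ω} with hE₂
  set E₃ : Set Ω := {ω | countVersion N T l t ω < k ∧ k < countVersion N T l t' ω} with hE₃
  have hE₂m : MeasurableSet E₂ := (hm (measurableSet_singleton k)).inter (hm' measurableSet_Ioi)
  have hE₃m : MeasurableSet E₃ := (hm measurableSet_Iio).inter (hm' measurableSet_Ioi)
  have hae : {ω | countVersion N T l t ω < k + 1} =ᵐ[P] (E₁ ∪ (E₂ ∪ E₃) : Set Ω) := by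
    filter_upwards [hX.ae_measure_thinnedRegion] with ω h1
    have hmono := count_mono (x := fun t => countVersion N T l t ω) h1 ht.le htt' ht'
    change (countVersion N T l t ω < k + 1) = (countVersion N T l t' ω < k + 1 ∨
      (countVersion N T l t ω = k ∧ k < countVersion N T l t' ω) ∨
      (countVersion N T l t ω < k ∧ k < countVersion N T l t' ω))
    apply propext
    omega
  have hsplit : distribution P N T l (k + 1) t
      = distribution P N T l (k + 1) t' + (P.real E₂ + P.real E₃) := by
    unfold distribution
    rw [measureReal_congr hae, measureReal_union ?_ (hE₂m.union hE₃m), measureReal_union ?_ hE₃m]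
    · exact Set.disjoint_left.2 fun ω h h' => by
        have := h.1; have := h'.1; omega
    · refine Set.disjoint_left.2 fun ω (h : _ < k + 1) h' => ?_
      rcases h' with h' | h' <;> (have := h'.2; omega)
  have hp := hX.distribution_succ hT k htT
  have hE₂r := hX.measureReal_jump hT hf hs k ht htt' ht'
  have hE₃r := hX.measureReal_double_jump_le hT (k := k) ht htt' ht' hC0
    fun j hj s h => hC j hj s ⟨hrt.trans h.1, h.2⟩
  have hval : distribution P N T l (k + 1) t' - distribution P N T l (k + 1) t +
      (distribution P N T l (k + 1) t - distribution P N T l k t) *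
        (1 - Real.exp (-(cumulativeRate T f k t' - cumulativeRate T f k t))) = -P.real E₃ := by
    rw [show distribution P N T l (k + 1) t - distribution P N T l k t
      = P.real {ω | countVersion N T l t ω = k} by linarith, ← hE₂r]
    linarith
  rw [hval, abs_neg, abs_of_nonneg measureReal_nonneg]
  exact hE₃r

/-- The process starts in the state `0`. -/
lemma IsPoissonFollmer.tendsto_distribution_one [IsProbabilityMeasure P]
    (hX : IsPoissonFollmer P N T f X l) (hT : 0 < T) :
    Tendsto (fun n : ℕ => distribution P N T l 1 (T / (n + 1))) atTop (𝓝 1) := by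
  set r : ℕ → ℝ := fun n => T / (n + 1) with hr
  have hrT : ∀ n, r n ∈ Icc 0 T := fun n => Ioc_subset_Icc_self (div_succ_mem_Ioc hT n)
  have hranti : Antitone r := fun m n h => by simp only [hr]; gcongr
  have hr0 : Tendsto r atTop (𝓝 0) := tendsto_nhds_of_tendsto_nhdsWithin (tendsto_div_succ hT)
  set E : ℕ → Set Ω := fun n => {ω | N ω (thinnedRegion T l (r n) ω) = 0} with hE
  have hEmono : Monotone E := fun m n h ω hω =>
    measure_mono_null (thinnedRegion_mono (hranti h)) hω
  have hUnion : P (⋃ n, E n) = 1 := by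
    have hmem : (⋃ n, E n) ∈ ae P := by
      filter_upwards [hX.ae_measure_thinnedRegion, hX.ae_line 0] with ω h1 h2
      by_contra hne
      have hpos : ∀ n, 1 ≤ N ω (thinnedRegion T l (r n) ω) := by
        intro n
        have h3 : N ω (thinnedRegion T l (r n) ω) ≠ 0 := fun h => hne (mem_iUnion.2 ⟨n, h⟩)
        rw [h1 _ (hrT n)] at h3 ⊢
        exact_mod_cast Nat.one_le_iff_ne_zero.2 (by exact_mod_cast h3)
      have hinf : N ω (⋂ n, thinnedRegion T l (r n) ω) = ⨅ n, N ω (thinnedRegion T l (r n) ω) := by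
        refine Antitone.measure_iInter (fun m n h => thinnedRegion_mono (hranti h))
          (fun n => (measurableSet_thinnedRegion hT.le hX.predictable (hrT n) ω).nullMeasurableSet)
          ⟨0, ?_⟩
        rw [h1 _ (hrT 0)]
        exact ENNReal.natCast_ne_top _
      have hsub : ⋂ n, thinnedRegion T l (r n) ω ⊆ {0} ×ˢ univ := by
        intro p hp
        have hp' := mem_iInter.1 hp
        refine ⟨le_antisymm (ge_of_tendsto' hr0 fun n => (hp' n).2.1.le) (hp' 0).1.1.1, mem_univ _⟩
      have h4 : (1 : ℝ≥0∞) ≤ N ω (⋂ n, thinnedRegion T l (r n) ω) := hinf ▸ le_iInf hpos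
      rw [measure_mono_null hsub h2] at h4
      exact absurd h4 (by simp)
    rw [measure_congr (eventuallyEq_univ.2 hmem), measure_univ]
  have hlim := tendsto_measure_iUnion_atTop (μ := P) hEmono
  rw [hUnion] at hlim
  have hlim' := (ENNReal.tendsto_toReal ENNReal.one_ne_top).comp hlim
  rw [ENNReal.toReal_one] at hlim'
  refine hlim'.congr fun n => ?_
  have hae : {ω | countVersion N T l (r n) ω < 1} =ᵐ[P] E n := by
    filter_upwards [hX.ae_measure_thinnedRegion] with ω h1
    change (countVersion N T l (r n) ω < 1) = (N ω (thinnedRegion T l (r n) ω) = 0)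
    rw [h1 _ (hrT n), Nat.cast_eq_zero, Nat.lt_one_iff]
  exact (measureReal_congr hae).symm

/-- Induction over the states: given the masses below `k`, the difference at `k + 1` is bounded by
its value at the times `T / (n + 1)`, which tends to `0` with them. -/
theorem IsPoissonFollmer.distribution_eq [IsProbabilityMeasure P]
    (hX : IsPoissonFollmer P N T f X l) (hT : 0 < T) (hf : ∀ k, 0 < f k)
    (hf_one : HasSum (fun k => f k * poissonWeight T k) 1) (k : ℕ) :
    ∀ t ∈ Ioc 0 T, distribution P N T l k t = lowerMass T f k t := by
  have hs := hf_one.summable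
  induction k with
  | zero => intro t ht; simp [distribution, lowerMass]
  | succ k ih =>
    intro t ht
    have hrT := div_succ_mem_Ioc hT
    have hr0 := tendsto_div_succ hT
    have hG1 : ∀ s, distribution P N T l (k + 1) s ≤ 1 := fun s => measureReal_le_one
    have hG0 : ∀ s, distribution P N T l 1 s ≤ distribution P N T l (k + 1) s := fun s =>
      measureReal_mono fun ω h => lt_of_lt_of_le h (Nat.le_add_left 1 k)
    -- Both functions lie between their values for `k = 0` and `1`, which merge at time `0`.
    have hsmall : ∀ s ∈ Ioc 0 T,
        |distribution P N T l (k + 1) s - lowerMass T f (k + 1) s|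
          ≤ (1 - distribution P N T l 1 s) + (1 - lowerMass T f 1 s) := by
      intro s h
      have h1 := lowerMass_le_one hT hf hf_one (k + 1) h
      have h2 := lowerMass_one_le hT hf hs k h
      have h3 := hG1 s
      have h4 := hG0 s
      rw [abs_le]
      constructor <;> linarith [lowerMass_le_one hT hf hf_one 1 h,
        (measureReal_le_one : distribution P N T l 1 s ≤ 1)]
    have hbound : ∀ᶠ n : ℕ in atTop,
        |distribution P N T l (k + 1) t - lowerMass T f (k + 1) t|
          ≤ (1 - distribution P N T l 1 (T / (n + 1))) + (1 - lowerMass T f 1 (T / (n + 1))) := by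
      filter_upwards [(tendsto_nhds_of_tendsto_nhdsWithin hr0).eventually_lt_const ht.1] with n hn
      refine le_trans ?_ (hsmall _ (hrT n))
      obtain ⟨C, hC⟩ := hX.exists_distribution_increment hT hf hs k (hrT n).1
      refine abs_sub_lowerMass_le hT hf hs k (hrT n).1 (C := C) (fun s h => ?_)
        (fun s s' h1 h2 h3 => ?_) ⟨hn.le, ht.2⟩
      · have hs0 : s ∈ Ioc 0 T := ⟨(hrT n).1.trans_le h.1, h.2⟩
        rw [← ih s hs0, hX.distribution_succ hT k (Ioc_subset_Icc_self hs0), add_sub_cancel_left,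
          abs_of_nonneg measureReal_nonneg]
        exact measureReal_le_one
      · rw [← ih s ⟨(hrT n).1.trans_le h1, h2.trans h3⟩]
        exact hC s s' h1 h2 h3
    have hlim := ((hX.tendsto_distribution_one hT).const_sub 1).add
      (((tendsto_lowerMass_one hT hf hf_one).comp hr0).const_sub 1)
    rw [sub_self, add_zero] at hlim
    have h := ge_of_tendsto hlim hbound
    exact sub_eq_zero.1 (abs_eq_zero.1 (le_antisymm h (abs_nonneg _)))

/-- The Poisson–Föllmer process has law `P_{T-t} f π_t` at time `t`. -/
theorem IsPoissonFollmer.measure_countVersion_eq [IsProbabilityMeasure P]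
    (hX : IsPoissonFollmer P N T f X l) (hT : 0 < T) (hf : ∀ k, 0 < f k)
    (hf_one : HasSum (fun k => f k * poissonWeight T k) 1) (k : ℕ) {t : ℝ} (ht : t ∈ Ioc 0 T) :
    P {ω | countVersion N T l t ω = k}
      = ENNReal.ofReal (evolved T f t k * poissonWeight t k) := by
  have h := hX.distribution_succ hT k (Ioc_subset_Icc_self ht)
  rw [hX.distribution_eq hT hf hf_one k t ht, hX.distribution_eq hT hf hf_one (k + 1) t ht,
    lowerMass, Finset.sum_range_succ, ← lowerMass] at h
  rw [add_left_cancel h, ofReal_measureReal]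

/-- Expectations of functions of the state at time `t`. -/
lemma IsPoissonFollmer.lintegral_comp [IsProbabilityMeasure P]
    (hX : IsPoissonFollmer P N T f X l) (hT : 0 < T) (hf : ∀ k, 0 < f k)
    (hf_one : HasSum (fun k => f k * poissonWeight T k) 1) (g : ℕ → ℝ≥0∞) {t : ℝ}
    (ht : t ∈ Ioc 0 T) :
    ∫⁻ ω, g (X t ω) ∂P = ∑' k, g k * ENNReal.ofReal (evolved T f t k * poissonWeight t k) := by
  have hm := hX.measurable_countVersion' hT (Ioc_subset_Icc_self ht)
  have hae : ∫⁻ ω, g (X t ω) ∂P = ∫⁻ ω, g (countVersion N T l t ω) ∂P := by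
    refine lintegral_congr_ae ?_
    filter_upwards [hX.ae_countVersion_eq] with ω h
    rw [h t (Ioc_subset_Icc_self ht)]
  rw [hae, ← lintegral_map (μ := P) (f := g) .of_discrete hm, lintegral_countable']
  refine tsum_congr fun k => ?_
  rw [Measure.map_apply hm (measurableSet_singleton k)]
  exact congrArg _ (hX.measure_countVersion_eq hT hf hf_one k ht)

end Law

end

end PoissonFollmer

open PoissonFollmer in
theorem proposition3p1
    {Ω : Type*} [MeasurableSpace Ω] (P : Measure Ω) [IsProbabilityMeasure P]
    (T : ℝ) (hT : 0 < T)
    (f : ℕ → ℝ) (hf : ∀ k, 0 < f k)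
    (hf_one : HasSum (fun k => f k * poissonWeight T k) 1)
    (hf_ent : Summable (fun k => f k * Real.log (f k) * poissonWeight T k))
    (N : Ω → Measure (ℝ × ℝ)) (X : ℝ → Ω → ℕ) (l : ℝ → Ω → ℝ)
    (hX : IsPoissonFollmer P N T f X l) :
    deficit T f =
      ((∫⁻ t in Icc 0 T, ∫⁻ s in Icc t T, ∫⁻ ω,
          ENNReal.ofReal (l s ω ^ 2) *
            InformationTheory.klDiv
              (poissonMeasure (Real.toNNReal (Real.exp
                (discreteDeriv (discreteDeriv (logSemigroup T f s)) (X s ω)))))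
              (poissonMeasure 1) ∂P : ℝ≥0∞) : EReal) := by
  have hs := hf_one.summable
  have key : ∀ s ∈ Ioc 0 T, ∫⁻ ω, ENNReal.ofReal (l s ω ^ 2) *
      InformationTheory.klDiv (poissonMeasure (Real.toNNReal (Real.exp
        (discreteDeriv (discreteDeriv (logSemigroup T f s)) (X s ω))))) (poissonMeasure 1) ∂P
      = entropyRateDerivAt T f s := by
    intro s hs0
    have hae : ∀ᵐ ω ∂P, l s ω = evolved T f s (X s ω + 1) / evolved T f s (X s ω) := by
      filter_upwards [hX.intensity] with ω h using h s (Ioc_subset_Icc_self hs0)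
    rw [lintegral_congr_ae (hae.mono fun ω h => by rw [h])]
    refine (hX.lintegral_comp hT hf hf_one (fun k =>
      ENNReal.ofReal ((evolved T f s (k + 1) / evolved T f s k) ^ 2) *
        InformationTheory.klDiv (poissonMeasure (Real.toNNReal (Real.exp
        (discreteDeriv (discreteDeriv (logSemigroup T f s)) k)))) (poissonMeasure 1)) hs0).trans ?_
    exact tsum_congr fun k => ofReal_sq_mul_klDiv_mul (evolved_pos hT hf hs k hs0)
      (evolved_pos hT hf hs (k + 1) hs0) (evolved_pos hT hf hs (k + 2) hs0)
  rw [deficit_eq_lintegral hT hf hf_one hf_ent, setLIntegral_congr Ioc_ae_eq_Icc.symm]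
  congr 1
  refine setLIntegral_congr_fun measurableSet_Ioc fun t ht => ?_
  rw [setLIntegral_congr Ioc_ae_eq_Icc.symm]
  exact (setLIntegral_congr_fun measurableSet_Ioc fun s h => key s ⟨ht.1.trans h.1, h.2⟩).symm
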